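/- Let $\mathcal A,\mathcal W$ be measurable spaces, let $\rho$ be a probability measure (the law of $(\mathbf a,\mathbf y,\mathbf w)$) on $\mathcal A\times\mathbb R\times\mathcal W$, and let $(\mathbf a,x)\mapsto\Psi_{\mathbf a}(x)$ on $\mathcal A\times\mathbb R^{d_x}$ and $(\mathbf w,z)\mapsto\Psi_{\mathbf w}(z)$ on $\mathcal W\times\mathbb R^{d_z}$ be real-valued functions, measurable in the first and differentiable in the second variable. Assume that $|\mathbf y|\le M$ $\rho$-almost surely and that $|\Psi_{\mathbf a}|,|\Psi_{\mathbf w}|,\|\nabla_x\Psi_{\mathbf a}\|,\|\nabla_z\Psi_{\mathbf w}\|\le R$ everywhere, for some constants $M,R$. Let $\zeta_1,\zeta_2>0$. Let $\mathcal P_2(\mathbb R^d)$ be the set of Borel probability measures on $\mathbb R^d$ with finite second moment, with the topology of weak convergence, and let $\mathrm{Ent}(\mu)=\int\mu(x)\log\mu(x)\,\mathrm dx\in(-\infty,+\infty]$ for $\mu\in\mathcal P_2(\mathbb R^d)$ with Lebesgue density $\mu(x)$, and $\mathrm{Ent}(\mu)=+\infty$ if $\mu$ has no density. Put $$U_1(\mu_x,\mu_z)=\tfrac12\mathbb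 E_\rho\Big[\Big(\int\Psi_{\mathbf w}\,\mathrm d\mu_z-\int\Psi_{\mathbf a}\,\mathrm d\mu_x\Big)^2\Big],\qquad U_2(\mu_z)=\tfrac12\mathbb E_\rho\Big[\Big(\int\Psi_{\mathbf w}\,\mathrm d\mu_z-\mathbf y\Big)^2\Big].$$ For $\sigma_1\ge0$ and $\mu_x\in\mathcal P_2(\mathbb R^{d_x})$ consider the Stage I problem of minimizing $$\mu_z\mapsto U_1(\mu_x,\mu_z)+\tfrac{\zeta_1}2\mathbb E_{\mu_z}[\|z\|^2]+\sigma_1\mathrm{Ent}(\mu_z)$$ over $\mathcal P_2(\mathbb R^{d_z})$, where the entropy term is omitted if $\sigma_1=0$. This problem has a solution, and any two solutions have the same value of $U_2$. Let $\mu^*_{z,\sigma_1}(\mu_x)$ be a solution, chosen arbitrarily for each $\sigma_1\ge 0$ and $\mu_x$, and for $\sigma_1,\sigma_2\ge0$ let $$\mathscr F_{2,(\sigma_1,\sigma_2)}(\mu_x)=U_2(\mu^*_{z,\sigma_1}(\mu_x))+\tfrac{\zeta_2}2\mathbb E_{\mu_x}[\|x\|^2]+\sigma_2\mathrm{Ent}(\mu_x),\qquad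 \mu_x\in\mathcal P_2(\mathbb R^{d_x}),$$ where again the entropy term is omitted if $\sigma_2=0$. Then for every sequence $(\sigma_{1,n},\sigma_{2,n})\to(0,0)$ with $\sigma_{1,n},\sigma_{2,n}>0$: 1. $\mathscr F_{2,(\sigma_{1,n},\sigma_{2,n})}$ $\Gamma$-converges to $\mathscr F_{2,(0,0)}$ on $\mathcal P_2(\mathbb R^{d_x})$ with respect to the weak topology. That is, $\liminf_{n}\mathscr F_{2,(\sigma_{1,n},\sigma_{2,n})}(\mu_n)\ge\mathscr F_{2,(0,0)}(\mu)$ whenever $\mu_n\to\mu$ weakly in $\mathcal P_2(\mathbb R^{d_x})$, and for every $\mu\in\mathcal P_2(\mathbb R^{d_x})$ there are $\mu_n\in\mathcal P_2(\mathbb R^{d_x})$ with $\mu_n\to\mu$ weakly and $\limsup_{n}\mathscr F_{2,(\sigma_{1,n},\sigma_{2,n})}(\mu_n)\le\mathscr F_{2,(0,0)}(\mu)$. 2. If $\mu_n$ is a global minimizer of $\mathscr F_{2,(\sigma_{1,n},\sigma_{2,n})}$ over $\mathcal P_2(\mathbb R^{d_x})$ for every $n$ and $\mu_n$ converges weakly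 to a probability measure $\mu^\diamond$ on $\mathbb R^{d_x}$, then $\mu^\diamond\in\mathcal P_2(\mathbb R^{d_x})$ and $\mu^\diamond$ is a global minimizer of $\mathscr F_{2,(0,0)}$ over $\mathcal P_2(\mathbb R^{d_x})$. -/

import Mathlib

open MeasureTheory Filter Topology

noncomputable section

namespace DFIV

/-- The parameter space `ℝ^d` with its Euclidean norm. -/
abbrev Eucl (d : ℕ) : Type := EuclideanSpace ℝ (Fin d)

/-- `𝒫₂(ℝ^d)`: the Borel probability measures on `ℝ^d` with finite second moment. As a subtype of
`ProbabilityMeasure` it carries the topology of weak convergence. -/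
abbrev P2 (d : ℕ) : Type :=
  {μ : ProbabilityMeasure (Eucl d) //
    Integrable (fun x : Eucl d => ‖x‖ ^ 2) (μ : Measure (Eucl d))}

/-- The Borel measure underlying an element of `𝒫₂(ℝ^d)`. -/
def P2.toMeasure {d : ℕ} (μ : P2 d) : Measure (Eucl d) := (μ.1 : Measure (Eucl d))

/-- Second moment `𝔼_μ[‖x‖²]`. -/
def secondMoment {d : ℕ} (μ : P2 d) : ℝ := ∫ x, ‖x‖ ^ 2 ∂μ.toMeasure

/-- The Lebesgue density of (the absolutely continuous part of) `μ`. -/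
def density {d : ℕ} (μ : P2 d) (x : Eucl d) : ℝ := (μ.toMeasure.rnDeriv volume x).toReal

open Classical in
/-- Negative entropy `Ent(μ) = ∫ μ(x) log μ(x) dx`, equal to `+∞` when `μ` has no Lebesgue density.
For `μ` with a density and finite second moment the negative part of `μ log μ` is integrable, so
that non-integrability of `μ log μ` means that the integral is `+∞`. -/
def Ent {d : ℕ} (μ : P2 d) : EReal :=
  if μ.toMeasure ≪ (volume : Measure (Eucl d)) ∧
      Integrable (fun x => density μ x * Real.log (density μ x)) (volume : Measure (Eucl d)) then
    ((∫ x, density μ x * Real.log (density μ x) : ℝ) : EReal)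
  else ⊤

/-- The mean field network `∫ Ψ_u(θ) dμ(θ)` evaluated at the input `u`. -/
def net {U : Type*} {d : ℕ} (Ψ : U → Eucl d → ℝ) (μ : P2 d) (u : U) : ℝ :=
  ∫ θ, Ψ u θ ∂μ.toMeasure

/-- `Ψ` is measurable in the input, differentiable in the parameter, and `|Ψ|`, `|∇Ψ|` are bounded
by `R`. -/
structure BoundedSmooth {U : Type*} [MeasurableSpace U] {d : ℕ}
    (Ψ : U → Eucl d → ℝ) (R : ℝ) : Prop where
  measurable_input : ∀ θ, Measurable fun u => Ψ u θ
  differentiable : ∀ u, Differentiable ℝ (Ψ u)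
  abs_le : ∀ u θ, |Ψ u θ| ≤ R
  gradient_le : ∀ u θ, ‖gradient (Ψ u) θ‖ ≤ R

section Objectives

variable {A W : Type*} [MeasurableSpace A] [MeasurableSpace W] {dx dz : ℕ}

/-- `U₁(μ_x, μ_z) = ½ 𝔼_ρ[(∫ Ψ_w dμ_z - ∫ Ψ_a dμ_x)²]`, with `ρ` the law of `(a, y, w)`. -/
def U₁ (ρ : Measure (A × ℝ × W)) (ΨA : A → Eucl dx → ℝ) (ΨW : W → Eucl dz → ℝ)
    (μx : P2 dx) (μz : P2 dz) : ℝ :=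
  (1 / 2) * ∫ t, (net ΨW μz t.2.2 - net ΨA μx t.1) ^ 2 ∂ρ

/-- `U₂(μ_z) = ½ 𝔼_ρ[(∫ Ψ_w dμ_z - y)²]`. -/
def U₂ (ρ : Measure (A × ℝ × W)) (ΨW : W → Eucl dz → ℝ) (μz : P2 dz) : ℝ :=
  (1 / 2) * ∫ t, (net ΨW μz t.2.2 - t.2.1) ^ 2 ∂ρ

/-- Stage I objective `U₁(μ_x, μ_z) + (ζ₁/2) 𝔼_{μ_z}[‖z‖²] + σ₁ Ent(μ_z)`. For `σ₁ = 0` the entropy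
term is absent, since `0 * ⊤ = 0` in `EReal`. -/
def stageI (ρ : Measure (A × ℝ × W)) (ΨA : A → Eucl dx → ℝ) (ΨW : W → Eucl dz → ℝ)
    (ζ₁ σ₁ : ℝ) (μx : P2 dx) (μz : P2 dz) : EReal :=
  ((U₁ ρ ΨA ΨW μx μz + ζ₁ / 2 * secondMoment μz : ℝ) : EReal) + (σ₁ : EReal) * Ent μz

/-- `μz` is a global minimizer over `𝒫₂(ℝ^{d_z})` of the Stage I objective at `μx`. -/
def IsStageISolution (ρ : Measure (A × ℝ × W)) (ΨA : A → Eucl dx → ℝ) (ΨW : W → Eucl dz → ℝ)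
    (ζ₁ σ₁ : ℝ) (μx : P2 dx) (μz : P2 dz) : Prop :=
  ∀ ν : P2 dz, stageI ρ ΨA ΨW ζ₁ σ₁ μx μz ≤ stageI ρ ΨA ΨW ζ₁ σ₁ μx ν

/-- Stage II objective `U₂(μ_z) + (ζ₂/2) 𝔼_{μ_x}[‖x‖²] + σ₂ Ent(μ_x)`. -/
def stageII (ρ : Measure (A × ℝ × W)) (ΨW : W → Eucl dz → ℝ) (ζ₂ σ₂ : ℝ)
    (μx : P2 dx) (μz : P2 dz) : EReal :=
  ((U₂ ρ ΨW μz + ζ₂ / 2 * secondMoment μx : ℝ) : EReal) + (σ₂ : EReal) * Ent μx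

/-- The nested Stage II objective `μ_x ↦ ℱ_{2,(σ₁,σ₂)}(μ_x, μ*_{z,σ₁}(μ_x))`, where `zstar σ₁ μ_x`
stands for the Stage I solution `μ*_{z,σ₁}(μ_x)`. -/
def nestedII (ρ : Measure (A × ℝ × W)) (ΨW : W → Eucl dz → ℝ) (ζ₂ : ℝ)
    (zstar : ℝ → P2 dx → P2 dz) (σ : ℝ × ℝ) (μx : P2 dx) : EReal :=
  stageII ρ ΨW ζ₂ σ.2 μx (zstar σ.1 μx)

end Objectives

/-- Sequential Γ-convergence of `F n` to `G`: the liminf inequality along every convergent sequence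
and the existence of recovery sequences. -/
structure GammaConverges {X : Type*} [TopologicalSpace X] (F : ℕ → X → EReal) (G : X → EReal) :
    Prop where
  le_liminf : ∀ (x : X) (u : ℕ → X), Tendsto u atTop (𝓝 x) →
    G x ≤ liminf (fun n => F n (u n)) atTop
  exists_recovery : ∀ x : X, ∃ u : ℕ → X, Tendsto u atTop (𝓝 x) ∧
    limsup (fun n => F n (u n)) atTop ≤ G x

end DFIV

end

/-! The network output is affine in the measure and `U₁` is a squared `L²(ρ)` distance between
outputs. Stage I is therefore convex in `μz`, and the parallelogram identity makes it strongly
convex in the output: if `μz` exceeds the minimum by `δ`, its output lies within squared `L²(ρ)`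
distance `4δ` of the optimal one (`IsStageISolution.integral_sq_le`). Since `U₂` sees `μz` only
through its output, and is Lipschitz in it, `U₂` takes one value on all solutions, even when the
measures differ.

The same estimate gives stability. Let `σ n → 0` and `μ n → μ₀`. The Stage I solutions at `(σ n, μ
n)` nearly minimize the unregularized problem at `μ₀`: they are compared with smoothings of a
solution there, whose entropy is `o(1 / σ n)`; negative entropy is absorbed by the second moment;
and replacing `μ n` by `μ₀` costs an error uniform in `μz`. So `U₂` converges along every weakly
convergent sequence (`tendsto_U₂_of_isStageISolution`), without any limit of the solutions being
taken.

What remains of the Γ-limit is the weakly lower semicontinuous second moment and a vanishing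
entropy, with the same smoothings as recovery sequences. A uniform second moment bound keeps limits
of minimizers in `𝒫₂`.

Existence in Stage I is the direct method. By Legendre duality, entropy plus a multiple of the
second moment is a supremum of weakly continuous functionals; bounded second moments give
compactness. -/

namespace DFIV

/-! ### Truncation tools for entropy duality -/

/-- Fatou's lemma for real integrands with an integrable lower bound. -/
theorem integrable_and_integral_le_of_tendsto {α : Type*} [MeasurableSpace α] {ν : Measure α}
    {F : ℕ → α → ℝ} {G g : α → ℝ} {r : ℝ} (hF : ∀ n, Integrable (F n) ν) (hg : Integrable g ν)
    (hFm : ∀ n, Measurable (F n)) (hgm : Measurable g)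
    (hle : ∀ n x, -g x ≤ F n x) (hint : ∀ n, ∫ x, F n x ∂ν ≤ r)
    (hlim : ∀ x, Tendsto (fun n => F n x) atTop (𝓝 (G x))) :
    Integrable G ν ∧ ∫ x, G x ∂ν ≤ r := by
  have hGm : Measurable G := measurable_of_tendsto_metrizable hFm (tendsto_pi_nhds.2 hlim)
  have hGle : ∀ x, 0 ≤ G x + g x := fun x => by
    have := ge_of_tendsto' (hlim x) (fun n => hle n x)
    linarith
  have key : ∫⁻ x, ENNReal.ofReal (G x + g x) ∂ν ≤ ENNReal.ofReal (r + ∫ x, g x ∂ν) := by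
    have h1 : ∀ x, ENNReal.ofReal (G x + g x)
        = liminf (fun n => ENNReal.ofReal (F n x + g x)) atTop := fun x =>
      (((ENNReal.continuous_ofReal.tendsto _).comp ((hlim x).add_const (g x))).liminf_eq).symm
    simp_rw [h1]
    refine (lintegral_liminf_le fun n => ((hFm n).add hgm).ennreal_ofReal).trans ?_
    refine liminf_le_of_frequently_le' (Frequently.of_forall fun n => ?_)
    rw [← ofReal_integral_eq_lintegral_ofReal ((hF n).add hg)
      (Eventually.of_forall fun x => by
        have := hle n x
        simp only [Pi.zero_apply, Pi.add_apply]
        linarith)]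
    refine ENNReal.ofReal_le_ofReal ?_
    rw [integral_add' (hF n) hg]
    linarith [hint n]
  have hsum : Integrable (fun x => G x + g x) ν := by
    refine ⟨(hGm.add hgm).aestronglyMeasurable, ?_⟩
    rw [hasFiniteIntegral_iff_ofReal (Eventually.of_forall hGle)]
    exact key.trans_lt ENNReal.ofReal_lt_top
  have hG : Integrable G ν := by
    refine (hsum.sub hg).congr (Eventually.of_forall fun x => ?_)
    simp
  refine ⟨hG, ?_⟩
  rw [← ofReal_integral_eq_lintegral_ofReal hsum (Eventually.of_forall hGle)] at key
  have hpos : 0 ≤ r + ∫ x, g x ∂ν := by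
    have h0 : 0 ≤ ∫ x, F 0 x + g x ∂ν := integral_nonneg fun x => by
      have := hle 0 x; simp only [Pi.zero_apply]; linarith
    rw [integral_add (hF 0) hg] at h0
    linarith [hint 0]
  rw [ENNReal.ofReal_le_ofReal_iff hpos, integral_add hG hg] at key
  linarith

/-- Fenchel–Young inequality for the conjugate pair `t log t` and `exp (s - 1)`. -/
theorem mul_sub_exp_le_mul_log {t : ℝ} (ht : 0 ≤ t) (s : ℝ) :
    t * s - Real.exp (s - 1) ≤ t * Real.log t := by
  rcases ht.eq_or_lt with rfl | ht
  · simp [Real.exp_nonneg]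
  · have h1 := Real.add_one_le_exp (s - 1 - Real.log t)
    have h2 : Real.exp (s - 1) = t * Real.exp (s - 1 - Real.log t) := by
      rw [Real.exp_sub (s - 1), Real.exp_log ht]; field_simp
    rw [h2]
    nlinarith

/-- Truncation of `t` to the interval `[1/(n+1), n+1]`. -/
noncomputable def clip (n : ℕ) (t : ℝ) : ℝ := max (min t (n + 1)) (1 / (n + 1))

theorem clip_pos (n : ℕ) (t : ℝ) : 0 < clip n t := lt_max_of_lt_right (by positivity)

theorem one_div_le_one (n : ℕ) : (1 : ℝ) / (n + 1) ≤ 1 := by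
  rw [div_le_one (by positivity)]; linarith [n.cast_nonneg (α := ℝ)]

theorem clip_le (n : ℕ) (t : ℝ) : clip n t ≤ n + 1 :=
  max_le (min_le_right _ _) ((one_div_le_one n).trans (by linarith [n.cast_nonneg (α := ℝ)]))

theorem abs_log_clip_le (n : ℕ) (t : ℝ) : |Real.log (clip n t)| ≤ Real.log (n + 1) := by
  rw [abs_le]
  refine ⟨?_, Real.log_le_log (clip_pos n t) (clip_le n t)⟩
  rw [← Real.log_inv, ← one_div]
  exact Real.log_le_log (by positivity) (le_max_right _ _)

theorem measurable_clip (n : ℕ) : Measurable (clip n) := by unfold clip; fun_prop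

theorem tendsto_clip {t : ℝ} (ht : 0 ≤ t) : Tendsto (fun n => clip n t) atTop (𝓝 t) := by
  have h1 : Tendsto (fun n : ℕ => min t ((n : ℝ) + 1)) atTop (𝓝 t) := by
    refine tendsto_const_nhds.congr' ?_
    filter_upwards [eventually_ge_atTop ⌈t⌉₊] with n hn
    rw [min_eq_left]
    have := (Nat.le_ceil t).trans (Nat.cast_le.2 hn)
    linarith
  have := h1.max (tendsto_one_div_add_atTop_nhds_zero_nat (𝕜 := ℝ))
  rwa [max_eq_left ht] at this

/-- `s ↦ t * s - exp (s - 1)` is concave with its maximum at `1 + log t`, and the truncated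
maximizer lies between this point and `1`. -/
theorem neg_one_le_clip {t : ℝ} (ht : 0 ≤ t) (n : ℕ) :
    -1 ≤ t * (1 + Real.log (clip n t)) - clip n t := by
  have hc := clip_pos n t
  have hn := one_div_le_one n
  have hn' : (1 : ℝ) ≤ n + 1 := by linarith [n.cast_nonneg (α := ℝ)]
  rcases lt_trichotomy (clip n t) 1 with h | h | h
  · have htc : t ≤ clip n t := by
      have h1 : min t (n + 1) ≤ clip n t := le_max_left _ _
      rcases min_le_iff.1 h1 with h2 | h2 <;> linarith
    have hlog := mul_le_mul_of_nonneg_left (Real.one_sub_inv_le_log_of_pos hc) hc.le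
    rw [mul_sub, mul_inv_cancel₀ hc.ne'] at hlog
    nlinarith [Real.log_nonpos hc.le h.le]
  · rw [h, Real.log_one]; linarith
  · have htc : clip n t ≤ t := by
      rcases le_max_iff.1 (le_refl (clip n t)) with h2 | h2
      · exact h2.trans (min_le_left _ _)
      · linarith
    nlinarith [Real.log_nonneg h.le]

/-! ### Legendre duality for the entropy -/

variable {d : ℕ}

theorem integrable_exp_neg_mul_sq_norm {a : ℝ} (ha : 0 < a) :
    Integrable (fun x : Eucl d => Real.exp (-(a * ‖x‖ ^ 2))) := by
  have h := (GaussianFourier.integrable_cexp_neg_mul_sq_norm_add (b := (a : ℂ)) (V := Eucl d)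
    (by simpa using ha) 0 0).norm
  refine h.congr (Eventually.of_forall fun x => ?_)
  simp only [Complex.norm_exp]
  norm_num [← Complex.ofReal_pow]

theorem integrable_exp_sub_mul_sq_norm {a : ℝ} (ha : 0 < a) {φ : Eucl d → ℝ} (hφ : Measurable φ)
    {N : ℝ} (hN : ∀ x, |φ x| ≤ N) :
    Integrable (fun x : Eucl d => Real.exp (φ x - a * ‖x‖ ^ 2 - 1)) := by
  refine ((integrable_exp_neg_mul_sq_norm ha).const_mul (Real.exp N)).mono'
    (by fun_prop) (Eventually.of_forall fun x => ?_)
  rw [Real.norm_eq_abs, Real.abs_exp, ← Real.exp_add]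
  exact Real.exp_le_exp.2 (by linarith [(abs_le.1 (hN x)).2])

/-- The convex conjugate `∫ exp (φ(x) - a‖x‖² - 1) dx` of `μ ↦ Ent μ + a 𝔼_μ[‖x‖²]`. -/
noncomputable def entConj (a : ℝ) (φ : Eucl d → ℝ) : ℝ := ∫ x, Real.exp (φ x - a * ‖x‖ ^ 2 - 1)

instance (μ : P2 d) : IsProbabilityMeasure μ.toMeasure := by unfold P2.toMeasure; infer_instance

theorem P2.integrable_sq_norm (μ : P2 d) : Integrable (fun x => ‖x‖ ^ 2) μ.toMeasure := μ.2

theorem integrable_of_abs_le (μ : P2 d) {φ : Eucl d → ℝ} (hφ : Measurable φ) {N : ℝ}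
    (hN : ∀ x, |φ x| ≤ N) : Integrable φ μ.toMeasure :=
  (integrable_const N).mono' hφ.aestronglyMeasurable (Eventually.of_forall hN)

theorem measurable_density (μ : P2 d) : Measurable (density μ) :=
  (Measure.measurable_rnDeriv _ _).ennreal_toReal

theorem density_nonneg (μ : P2 d) (x : Eucl d) : 0 ≤ density μ x := ENNReal.toReal_nonneg

theorem integral_density_mul {μ : P2 d} (h : μ.toMeasure ≪ volume) (φ : Eucl d → ℝ) :
    ∫ x, density μ x * φ x = ∫ x, φ x ∂μ.toMeasure :=
  integral_rnDeriv_smul h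

theorem integrable_density_mul {μ : P2 d} (h : μ.toMeasure ≪ volume) {φ : Eucl d → ℝ}
    (hφ : Integrable φ μ.toMeasure) : Integrable (fun x => density μ x * φ x) :=
  (integrable_rnDeriv_smul_iff h).2 hφ

/-- Legendre duality for the entropy, upper bound on the dual objective. -/
theorem dual_le_ent (μ : P2 d) {a : ℝ} (ha : 0 < a) {φ : Eucl d → ℝ} (hφ : Measurable φ)
    {N : ℝ} (hN : ∀ x, |φ x| ≤ N) :
    ((∫ x, φ x ∂μ.toMeasure - a * secondMoment μ - entConj a φ : ℝ) : EReal) ≤ Ent μ := by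
  unfold Ent
  split_ifs with h
  · obtain ⟨hac, hint⟩ := h
    have hI : Integrable (fun x => φ x - a * ‖x‖ ^ 2) μ.toMeasure :=
      (integrable_of_abs_le μ hφ hN).sub (μ.integrable_sq_norm.const_mul a)
    have hE := integrable_exp_sub_mul_sq_norm ha hφ hN
    have hI' := integrable_density_mul hac hI
    rw [EReal.coe_le_coe_iff]
    have : ∫ x, φ x ∂μ.toMeasure - a * secondMoment μ - entConj a φ
        = ∫ x, (density μ x * (φ x - a * ‖x‖ ^ 2) - Real.exp (φ x - a * ‖x‖ ^ 2 - 1)) := by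
      rw [integral_sub hI' hE, integral_density_mul hac,
        integral_sub (integrable_of_abs_le μ hφ hN) (μ.integrable_sq_norm.const_mul a),
        integral_const_mul]
      rfl
    rw [this]
    exact integral_mono (hI'.sub hE) hint fun x =>
      mul_sub_exp_le_mul_log (density_nonneg μ x) _
  · exact le_top

/-- The duality proof needs discontinuous test functions (indicators, truncated log-densities). A
bounded measurable `φ` is a limit of bounded continuous functions almost everywhere for `μ` and for
Lebesgue measure at once. The finite measure `γ` stands in for the latter, so that density in `L¹`
applies to `μ + γ`. -/
theorem dual_le_of_forall_boundedContinuous (μ : P2 d) {a r : ℝ} (ha : 0 < a)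
    (h : ∀ φ : BoundedContinuousFunction (Eucl d) ℝ, ∫ x, φ x ∂μ.toMeasure - entConj a φ ≤ r)
    {φ : Eucl d → ℝ} (hφ : Measurable φ) {N : ℝ} (hN : ∀ x, |φ x| ≤ N) :
    ∫ x, φ x ∂μ.toMeasure - entConj a φ ≤ r := by
  have hN0 : 0 ≤ N := (abs_nonneg _).trans (hN 0)
  set γ : Measure (Eucl d) := volume.withDensity fun x => ENNReal.ofReal (Real.exp (-(a * ‖x‖ ^ 2)))
  have : IsFiniteMeasure γ :=
    isFiniteMeasure_withDensity_ofReal (integrable_exp_neg_mul_sq_norm ha).hasFiniteIntegral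
  have hmem : MemLp φ 1 (μ.toMeasure + γ) :=
    MemLp.of_bound hφ.aestronglyMeasurable N (Eventually.of_forall hN)
  choose g hg hgm using fun n : ℕ => hmem.exists_boundedContinuous_eLpNorm_sub_le
    ENNReal.one_ne_top (ε := (n + 1 : ENNReal)⁻¹) (by simp)
  have hlim : Tendsto (fun n => eLpNorm ((g n : Eucl d → ℝ) - φ) 1 (μ.toMeasure + γ)) atTop
      (𝓝 0) := by
    refine tendsto_of_tendsto_of_tendsto_of_le_of_le tendsto_const_nhds
      ((tendsto_add_atTop_iff_nat 1).2 ENNReal.tendsto_inv_nat_nhds_zero) (fun _ => zero_le) ?_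
    intro n
    simpa [eLpNorm_sub_comm] using hg n
  obtain ⟨ns, -, hns⟩ := (tendstoInMeasure_of_tendsto_eLpNorm one_ne_zero
    (fun n => (g n).continuous.aestronglyMeasurable) hφ.aestronglyMeasurable
    hlim).exists_seq_tendsto_ae
  -- Clipping to `[-N, N]` preserves the limit and supplies the domination.
  let ψ : ℕ → BoundedContinuousFunction (Eucl d) ℝ := fun n =>
    BoundedContinuousFunction.ofNormedAddCommGroup (fun x => max (min (g (ns n) x) N) (-N))
      (by fun_prop) N
      (fun x => abs_le.2 ⟨le_max_right _ _, max_le (min_le_right _ _) (by linarith)⟩)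
  have hψN : ∀ n x, |ψ n x| ≤ N := fun n x =>
    abs_le.2 ⟨le_max_right _ _, max_le (min_le_right _ _) (by linarith)⟩
  have hψ : ∀ᵐ x ∂(μ.toMeasure + γ), Tendsto (fun n => ψ n x) atTop (𝓝 (φ x)) := by
    filter_upwards [hns] with x hx
    have := (hx.min (tendsto_const_nhds (x := N))).max (tendsto_const_nhds (x := -N))
    rwa [min_eq_left (abs_le.1 (hN x)).2, max_eq_left (abs_le.1 (hN x)).1] at this
  rw [ae_add_measure_iff] at hψ
  have hvol : (volume : Measure (Eucl d)) ≪ γ :=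
    withDensity_absolutelyContinuous' (by fun_prop)
      (Eventually.of_forall fun x => by simp [Real.exp_pos])
  have h1 : Tendsto (fun n => ∫ x, ψ n x ∂μ.toMeasure) atTop (𝓝 (∫ x, φ x ∂μ.toMeasure)) :=
    tendsto_integral_of_dominated_convergence (fun _ => N)
      (fun n => (ψ n).continuous.aestronglyMeasurable) (integrable_const N)
      (fun n => Eventually.of_forall (hψN n)) hψ.1
  have h2 : Tendsto (fun n => entConj a (ψ n)) atTop (𝓝 (entConj a φ)) := by
    refine tendsto_integral_of_dominated_convergence (fun x => Real.exp (N - a * ‖x‖ ^ 2 - 1))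
      (fun n => by fun_prop) (integrable_exp_sub_mul_sq_norm ha measurable_const (fun _ => le_rfl))
      (fun n => Eventually.of_forall fun x => ?_) ?_
    · rw [Real.norm_eq_abs, Real.abs_exp]
      exact Real.exp_le_exp.2 (by linarith [(abs_le.1 (hψN n x)).2])
    · filter_upwards [hvol.ae_le hψ.2] with x hx
      exact (Real.continuous_exp.tendsto _).comp ((hx.sub_const _).sub_const _)
  exact le_of_tendsto' (h1.sub h2) fun n => h (ψ n)

/-- Legendre duality for the entropy: a bound on the dual objective bounds the entropy. -/
theorem ent_le_of_forall_dual_le (μ : P2 d) {a r : ℝ} (ha : 0 < a)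
    (h : ∀ φ : BoundedContinuousFunction (Eucl d) ℝ,
      ∫ x, φ x ∂μ.toMeasure - a * secondMoment μ - entConj a φ ≤ r) : Ent μ ≤ r := by
  have hB : ∀ {φ : Eucl d → ℝ} (_ : Measurable φ) {N : ℝ} (_ : ∀ x, |φ x| ≤ N),
      ∫ x, φ x ∂μ.toMeasure - entConj a φ ≤ r + a * secondMoment μ := fun {_} hφ {_} hN =>
    dual_le_of_forall_boundedContinuous μ ha (fun φ => by linarith [h φ]) hφ hN
  -- The test function `n · 1_s` on a Lebesgue null set `s` leaves `entConj` unchanged, so `n μ(s)`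
  -- stays bounded in `n`.
  have hac : μ.toMeasure ≪ volume := by
    refine Measure.AbsolutelyContinuous.mk fun s hs hs0 => ?_
    have hn : ∀ n : ℕ, n * μ.toMeasure.real s
        ≤ r + a * secondMoment μ + entConj a (0 : Eucl d → ℝ) := by
      intro n
      have h1 := hB (φ := s.indicator fun _ => (n : ℝ)) (measurable_const.indicator hs) (N := n)
        (fun x => by by_cases hx : x ∈ s <;> simp [hx])
      have h2 : entConj a (s.indicator fun _ => (n : ℝ)) = entConj a (0 : Eucl d → ℝ) := by
        refine integral_congr_ae ?_
        filter_upwards [measure_eq_zero_iff_ae_notMem.1 hs0] with x hx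
        simp [hx]
      rw [h2, integral_indicator_const _ hs, smul_eq_mul] at h1
      linarith
    have h0 : μ.toMeasure.real s ≤ 0 := by
      by_contra! hpos
      obtain ⟨n, hn'⟩ := exists_nat_gt
        ((r + a * secondMoment μ + entConj a (0 : Eucl d → ℝ)) / μ.toMeasure.real s)
      rw [div_lt_iff₀ hpos] at hn'
      linarith [hn n]
    exact (measureReal_eq_zero_iff).1 (le_antisymm h0 measureReal_nonneg)
  -- `t` is the density of `μ` relative to `exp (-a‖x‖²) dx`. The optimal test function is `1 + log
  -- t`; its truncations `φ n` are admissible, and `neg_one_le_clip` gives the integrable lower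
  -- bound for Fatou.
  set t : Eucl d → ℝ := fun x => density μ x * Real.exp (a * ‖x‖ ^ 2) with ht
  have ht0 : ∀ x, 0 ≤ t x := fun x => mul_nonneg (density_nonneg μ x) (Real.exp_nonneg _)
  have htm : Measurable t := (measurable_density μ).mul (by fun_prop)
  have hte : ∀ x, density μ x = Real.exp (-(a * ‖x‖ ^ 2)) * t x := fun x => by
    rw [ht, mul_comm, mul_assoc, ← Real.exp_add]; simp
  let φ : ℕ → Eucl d → ℝ := fun n x => 1 + Real.log (clip n (t x))
  have hφm : ∀ n, Measurable (φ n) := fun n =>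
    ((Real.measurable_log.comp ((measurable_clip n).comp htm)).const_add 1)
  have hφN : ∀ n x, |φ n x| ≤ 1 + Real.log (n + 1) := fun n x =>
    (abs_add_le _ _).trans (by simpa using abs_log_clip_le n (t x))
  have hexp : ∀ n x, Real.exp (φ n x - a * ‖x‖ ^ 2 - 1)
      = Real.exp (-(a * ‖x‖ ^ 2)) * clip n (t x) := fun n x => by
    rw [show φ n x - a * ‖x‖ ^ 2 - 1 = -(a * ‖x‖ ^ 2) + Real.log (clip n (t x)) by
      simp only [φ]; ring, Real.exp_add, Real.exp_log (clip_pos _ _)]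
  have hi1 := fun n => integrable_density_mul hac (integrable_of_abs_le μ (hφm n) (hφN n))
  have hi2 := fun n => integrable_exp_sub_mul_sq_norm ha (hφm n) (hφN n)
  obtain ⟨hI, hIle⟩ := integrable_and_integral_le_of_tendsto (ν := (volume : Measure (Eucl d)))
    (F := fun n x => density μ x * φ n x - Real.exp (φ n x - a * ‖x‖ ^ 2 - 1))
    (G := fun x => Real.exp (-(a * ‖x‖ ^ 2)) * (t x * Real.log (t x)))
    (g := fun x => Real.exp (-(a * ‖x‖ ^ 2))) (r := r + a * secondMoment μ)
    (fun n => (hi1 n).sub (hi2 n)) (integrable_exp_neg_mul_sq_norm ha)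
    (fun n => ((measurable_density μ).mul (hφm n)).sub (by have := hφm n; fun_prop))
    (by fun_prop)
    (fun n x => by
      rw [hexp, hte x, mul_assoc, ← mul_sub]
      have := mul_le_mul_of_nonneg_left (neg_one_le_clip (ht0 x) n)
        (Real.exp_nonneg (-(a * ‖x‖ ^ 2)))
      simpa using this)
    (fun n => by
      rw [integral_sub (hi1 n) (hi2 n), integral_density_mul hac]
      exact hB (hφm n) (hφN n))
    (fun x => by
      have hlim : Tendsto (fun n => t x * (1 + Real.log (clip n (t x))) - clip n (t x)) atTop
          (𝓝 (t x * Real.log (t x))) := by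
        rcases (ht0 x).eq_or_lt with h0 | h0
        · have := (tendsto_clip (ht0 x)).neg
          simpa [← h0] using this
        · have h1 := tendsto_clip (ht0 x)
          have h2 := ((((Real.continuousAt_log h0.ne').tendsto.comp h1).const_add 1).const_mul
            (t x)).sub h1
          rwa [show t x * (1 + Real.log (t x)) - t x = t x * Real.log (t x) by ring] at h2
      refine (hlim.const_mul (Real.exp (-(a * ‖x‖ ^ 2)))).congr fun n => ?_
      rw [hexp, hte x]
      ring)
  have hm2 := integrable_density_mul hac (μ.integrable_sq_norm.const_mul a)
  have heq : ∀ x, density μ x * Real.log (density μ x)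
      = Real.exp (-(a * ‖x‖ ^ 2)) * (t x * Real.log (t x)) - density μ x * (a * ‖x‖ ^ 2) := by
    intro x
    rw [← mul_assoc, ← hte x]
    rcases (density_nonneg μ x).eq_or_lt with h0 | h0
    · simp [← h0]
    · have : Real.log (t x) = Real.log (density μ x) + a * ‖x‖ ^ 2 := by
        rw [ht, Real.log_mul h0.ne' (Real.exp_pos _).ne', Real.log_exp]
      rw [this]; ring
  have hint : Integrable fun x => density μ x * Real.log (density μ x) := by
    simp_rw [heq]; exact hI.sub hm2
  unfold Ent
  rw [if_pos ⟨hac, hint⟩, EReal.coe_le_coe_iff]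
  simp_rw [heq]
  rw [integral_sub hI hm2, integral_density_mul hac, integral_const_mul]
  change _ - a * secondMoment μ ≤ r
  linarith

/-- The dual bound at `φ = 0`. Since `a` is arbitrary, any small share of the quadratic regularizer
can absorb the negative part of the entropy. -/
theorem neg_secondMoment_le_ent (μ : P2 d) {a : ℝ} (ha : 0 < a) :
    ((-(a * secondMoment μ) - entConj a (0 : Eucl d → ℝ) : ℝ) : EReal) ≤ Ent μ := by
  have h := dual_le_ent μ ha (φ := 0) measurable_zero (N := 0) (by simp)
  simpa using h

theorem ent_ne_bot (μ : P2 d) : Ent μ ≠ ⊥ := fun h => by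
  have := neg_secondMoment_le_ent μ one_pos
  rw [h, le_bot_iff] at this
  exact EReal.coe_ne_bot _ this

theorem secondMoment_nonneg (μ : P2 d) : 0 ≤ secondMoment μ :=
  integral_nonneg fun _ => by positivity

theorem P2.tendsto_integral {ι : Type*} {l : Filter ι} {u : ι → P2 d} {μ : P2 d}
    (h : Tendsto u l (𝓝 μ)) {φ : Eucl d → ℝ} (hφ : Continuous φ) {N : ℝ} (hN : ∀ x, |φ x| ≤ N) :
    Tendsto (fun i => ∫ x, φ x ∂(u i).toMeasure) l (𝓝 (∫ x, φ x ∂μ.toMeasure)) :=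
  ProbabilityMeasure.tendsto_iff_forall_integral_tendsto.1
    ((continuous_subtype_val.tendsto μ).comp h)
    (BoundedContinuousFunction.ofNormedAddCommGroup φ hφ N hN)

theorem BoundedContinuousFunction.abs_le_norm (φ : BoundedContinuousFunction (Eucl d) ℝ)
    (x : Eucl d) : |φ x| ≤ ‖φ‖ := φ.norm_coe_le_norm x

/-- The entropy, compensated by a multiple of the second moment, as a supremum of weakly continuous
affine functionals. -/
theorem secondMoment_add_ent_eq_iSup (μ : P2 d) {a : ℝ} (ha : 0 < a) :
    ((a * secondMoment μ : ℝ) : EReal) + Ent μ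
      = ⨆ φ : BoundedContinuousFunction (Eucl d) ℝ,
        ((∫ x, φ x ∂μ.toMeasure - entConj a φ : ℝ) : EReal) := by
  apply le_antisymm
  · refine EReal.le_of_forall_lt_iff_le.1 fun r hr => ?_
    have h : Ent μ ≤ ((r - a * secondMoment μ : ℝ) : EReal) := by
      refine ent_le_of_forall_dual_le μ ha fun φ => ?_
      have h1 := (le_iSup (fun φ : BoundedContinuousFunction (Eucl d) ℝ =>
        ((∫ x, φ x ∂μ.toMeasure - entConj a φ : ℝ) : EReal)) φ).trans hr.le
      rw [EReal.coe_le_coe_iff] at h1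
      linarith
    refine (add_le_add_right h _).trans ?_
    rw [← EReal.coe_add, EReal.coe_le_coe_iff]
    linarith
  · refine iSup_le fun φ => ?_
    have h := dual_le_ent μ ha φ.continuous.measurable (BoundedContinuousFunction.abs_le_norm φ)
    refine le_trans ?_ (add_le_add_right h _)
    rw [← EReal.coe_add, EReal.coe_le_coe_iff]
    linarith

theorem lowerSemicontinuous_secondMoment_add_ent {a : ℝ} (ha : 0 < a) :
    LowerSemicontinuous fun μ : P2 d => ((a * secondMoment μ : ℝ) : EReal) + Ent μ := by
  simp_rw [fun μ : P2 d => secondMoment_add_ent_eq_iSup μ ha]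
  refine lowerSemicontinuous_iSup fun φ => Continuous.lowerSemicontinuous ?_
  refine continuous_coe_real_ereal.comp (Continuous.sub ?_ continuous_const)
  exact continuous_iff_continuousAt.2 fun μ => P2.tendsto_integral tendsto_id φ.continuous
    (BoundedContinuousFunction.abs_le_norm φ)

/-! ### Second moments: lower semicontinuity and compactness -/

/-- A weak limit of measures with bounded second moments has a second moment with the same bound. -/
theorem integrable_sq_norm_of_tendsto {ι : Type*} {l : Filter ι} [l.NeBot] {u : ι → P2 d}
    {μ : ProbabilityMeasure (Eucl d)} (h : Tendsto (fun i => (u i).1) l (𝓝 μ)) {C : ℝ}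
    (hC : ∀ᶠ i in l, secondMoment (u i) ≤ C) :
    Integrable (fun x : Eucl d => ‖x‖ ^ 2) (μ : Measure (Eucl d)) ∧
      ∫ x, ‖x‖ ^ 2 ∂(μ : Measure (Eucl d)) ≤ C := by
  -- The truncations `min ‖x‖² k` are bounded and continuous, so their integrals pass to the weak
  -- limit; Fatou then removes `k`.
  have hb : ∀ (k : ℕ) (x : Eucl d), |min (‖x‖ ^ 2) (k : ℝ)| ≤ k := fun k x => by
    rw [abs_of_nonneg (by positivity)]; exact min_le_right _ _
  have hm : ∀ k : ℕ, Measurable fun x : Eucl d => min (‖x‖ ^ 2) (k : ℝ) := fun k => by fun_prop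
  refine integrable_and_integral_le_of_tendsto
    (F := fun (k : ℕ) (x : Eucl d) => min (‖x‖ ^ 2) (k : ℝ)) (g := 0)
    (fun k => (integrable_const (k : ℝ)).mono' (hm k).aestronglyMeasurable
      (Eventually.of_forall (hb k)))
    (integrable_zero _ _ _) hm measurable_zero
    (fun k x => by simp only [Pi.zero_apply, neg_zero]; positivity) (fun k => ?_) (fun x => ?_)
  · have := ProbabilityMeasure.tendsto_iff_forall_integral_tendsto.1 h
      (BoundedContinuousFunction.ofNormedAddCommGroup (fun x : Eucl d => min (‖x‖ ^ 2) (k : ℝ))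
        (by fun_prop) k (hb k))
    refine le_of_tendsto this ?_
    filter_upwards [hC] with i hi
    exact (integral_mono (integrable_of_abs_le (u i) (hm k) (hb k)) (u i).integrable_sq_norm
      fun x => min_le_left _ _).trans hi
  · refine tendsto_const_nhds.congr' ?_
    filter_upwards [eventually_ge_atTop ⌈‖x‖ ^ 2⌉₊] with k hk
    rw [min_eq_left ((Nat.le_ceil _).trans (Nat.cast_le.2 hk))]

/-- Otherwise `μ` is a limit along the part of its neighbourhood filter where the second moment is
at most `y`, and inherits that bound. -/
theorem lowerSemicontinuous_secondMoment : LowerSemicontinuous (secondMoment (d := d)) := by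
  intro μ y hy
  by_contra hcon
  rw [not_eventually] at hcon
  have : (𝓝 μ ⊓ 𝓟 {ν | secondMoment ν ≤ y}).NeBot := by
    simpa [frequently_iff_neBot] using hcon
  have h := (integrable_sq_norm_of_tendsto (l := 𝓝 μ ⊓ 𝓟 {ν | secondMoment ν ≤ y}) (u := id)
    ((continuous_subtype_val.tendsto μ).mono_left inf_le_left)
    (mem_inf_of_right (mem_principal_self _))).2
  exact absurd hy (not_lt.2 h)

theorem measure_norm_gt_le (μ : P2 d) {C : ℝ} (hC : secondMoment μ ≤ C) {r : ℝ} (hr : 0 < r) :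
    μ.toMeasure {x | r < ‖x‖} ≤ ENNReal.ofReal (C / r ^ 2) := by
  have h1 := mul_meas_ge_le_integral_of_nonneg (Eventually.of_forall fun x => by positivity)
    μ.integrable_sq_norm (r ^ 2)
  have h2 : μ.toMeasure.real {x | r < ‖x‖} ≤ μ.toMeasure.real {x | r ^ 2 ≤ ‖x‖ ^ 2} :=
    measureReal_mono (fun x (hx : r < ‖x‖) => by
      simp only [Set.mem_ofPred_eq]; gcongr)
  rw [← ofReal_measureReal]
  refine ENNReal.ofReal_le_ofReal ?_
  rw [le_div_iff₀ (by positivity)]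
  have : r ^ 2 * μ.toMeasure.real {x | r ^ 2 ≤ ‖x‖ ^ 2} ≤ C := h1.trans hC
  nlinarith [sq_nonneg r]

/-- Prokhorov: Chebyshev's inequality gives tightness, and the bound survives weak limits, which
therefore stay in `𝒫₂`. -/
theorem isCompact_secondMoment_le (C : ℝ) : IsCompact {μ : P2 d | secondMoment μ ≤ C} := by
  have hind : Topology.IsInducing (Subtype.val : P2 d → ProbabilityMeasure (Eucl d)) := ⟨rfl⟩
  rw [hind.isCompact_iff]
  set S : Set (ProbabilityMeasure (Eucl d)) := Subtype.val '' {μ : P2 d | secondMoment μ ≤ C}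
  have hclosed : IsClosed S := by
    refine isClosed_iff_clusterPt.2 fun μ hμ => ?_
    have hne : (comap Subtype.val (𝓝 μ) ⊓ 𝓟 {ν : P2 d | secondMoment ν ≤ C}).NeBot := by
      rw [← map_neBot_iff Subtype.val, Filter.push_pull', map_principal]
      exact hμ
    have h := integrable_sq_norm_of_tendsto
      (l := comap Subtype.val (𝓝 μ) ⊓ 𝓟 {ν : P2 d | secondMoment ν ≤ C}) (u := id)
      (tendsto_comap.mono_left inf_le_left) (mem_inf_of_right (mem_principal_self _))
    exact ⟨⟨μ, h.1⟩, h.2, rfl⟩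
  rw [← hclosed.closure_eq]
  apply isCompact_closure_of_isTightMeasureSet
  apply isTightMeasureSet_of_tendsto_measure_norm_gt
  have hlim : Tendsto (fun r : ℝ => ENNReal.ofReal (C / r ^ 2)) atTop (𝓝 0) := by
    rw [← ENNReal.ofReal_zero]
    exact (ENNReal.continuous_ofReal.tendsto 0).comp
      (tendsto_const_nhds.div_atTop (tendsto_pow_atTop two_ne_zero))
  refine tendsto_of_tendsto_of_tendsto_of_le_of_le' tendsto_const_nhds hlim
    (Eventually.of_forall fun _ => zero_le) ?_
  filter_upwards [eventually_gt_atTop 0] with r hr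
  refine iSup₂_le ?_
  rintro _ ⟨_, ⟨μ, hμ, rfl⟩, rfl⟩
  exact measure_norm_gt_le μ hμ hr

/-! ### Mixtures and convexity of the entropy -/

theorem isProbabilityMeasure_midpoint (μ ν : P2 d) : IsProbabilityMeasure
    ((2⁻¹ : ENNReal) • μ.toMeasure + (2⁻¹ : ENNReal) • ν.toMeasure) :=
  ⟨by simp [ENNReal.inv_two_add_inv_two]⟩

/-- The mixture `(μ + ν) / 2`. -/
noncomputable def P2.mid (μ ν : P2 d) : P2 d :=
  ⟨⟨(2⁻¹ : ENNReal) • μ.toMeasure + (2⁻¹ : ENNReal) • ν.toMeasure,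
    isProbabilityMeasure_midpoint μ ν⟩,
    (μ.integrable_sq_norm.smul_measure (by simp)).add_measure
      (ν.integrable_sq_norm.smul_measure (by simp))⟩

theorem P2.integral_mid (μ ν : P2 d) {φ : Eucl d → ℝ} (hμ : Integrable φ μ.toMeasure)
    (hν : Integrable φ ν.toMeasure) : ∫ x, φ x ∂(P2.mid μ ν).toMeasure
      = (∫ x, φ x ∂μ.toMeasure + ∫ x, φ x ∂ν.toMeasure) / 2 := by
  change ∫ x, φ x ∂((2⁻¹ : ENNReal) • μ.toMeasure + (2⁻¹ : ENNReal) • ν.toMeasure) = _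
  rw [integral_add_measure (hμ.smul_measure (by simp)) (hν.smul_measure (by simp)),
    integral_smul_measure, integral_smul_measure]
  simp only [ENNReal.toReal_inv, ENNReal.toReal_ofNat, smul_eq_mul]
  ring

theorem secondMoment_mid (μ ν : P2 d) :
    secondMoment (P2.mid μ ν) = (secondMoment μ + secondMoment ν) / 2 :=
  P2.integral_mid μ ν μ.integrable_sq_norm ν.integrable_sq_norm

/-- Each dual functional is affine in the measure, so its bound at the midpoint is the average of
the two bounds; no density of the mixture is computed. -/
theorem ent_mid_le {μ ν : P2 d} {e e' : ℝ} (hμ : Ent μ ≤ e) (hν : Ent ν ≤ e') :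
    Ent (P2.mid μ ν) ≤ (((e + e') / 2 : ℝ) : EReal) := by
  refine ent_le_of_forall_dual_le _ one_pos fun φ => ?_
  have hφ := BoundedContinuousFunction.abs_le_norm φ
  have hm := φ.continuous.measurable
  have h1 := EReal.coe_le_coe_iff.1 ((dual_le_ent μ one_pos hm hφ).trans hμ)
  have h2 := EReal.coe_le_coe_iff.1 ((dual_le_ent ν one_pos hm hφ).trans hν)
  rw [secondMoment_mid, P2.integral_mid μ ν (integrable_of_abs_le μ hm hφ)
    (integrable_of_abs_le ν hm hφ)]
  linarith

/-! ### Smoothing and recovery sequences -/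

/-- A measure whose density is bounded by `k` has entropy at most `log k`. -/
theorem ent_le_log_of_le_smul (μ : P2 d) {k : ℝ} (hk : 0 < k)
    (h : μ.toMeasure ≤ ENNReal.ofReal k • (volume : Measure (Eucl d))) :
    Ent μ ≤ (Real.log k : EReal) := by
  have hac : μ.toMeasure ≪ volume := Measure.absolutelyContinuous_of_le_smul h
  have hle : ∀ᵐ x : Eucl d, density μ x ≤ k := by
    have h1 : μ.toMeasure.rnDeriv volume ≤ᵐ[volume] fun _ => ENNReal.ofReal k := by
      refine ae_le_of_forall_setLIntegral_le_of_sigmaFinite (Measure.measurable_rnDeriv _ _)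
        fun s _ _ => ?_
      rw [setLIntegral_const]
      exact (Measure.setLIntegral_rnDeriv_le s).trans (h s)
    filter_upwards [h1] with x hx
    exact ENNReal.toReal_le_of_le_ofReal hk.le hx
  have hlog : ∀ᵐ x : Eucl d, density μ x * Real.log (density μ x)
      ≤ density μ x * Real.log k := by
    filter_upwards [hle] with x hx
    rcases (density_nonneg μ x).eq_or_lt with h0 | h0
    · simp [← h0]
    · exact mul_le_mul_of_nonneg_left (Real.log_le_log h0 hx) h0.le
  have hi1 : Integrable fun x => density μ x * Real.log k :=
    integrable_density_mul hac (integrable_const _)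
  -- Integrable minorant: Fenchel–Young with `s = -‖x‖²`.
  have hi0 := (integrable_density_mul hac (μ.integrable_sq_norm.const_mul (-1))).sub
    (integrable_exp_sub_mul_sq_norm (d := d) one_pos (φ := 0) measurable_zero (N := 0) (by simp))
  have hint : Integrable fun x => density μ x * Real.log (density μ x) := by
    refine integrable_of_le_of_le
      ((measurable_density μ).mul (measurable_density μ).log).aestronglyMeasurable
      (Eventually.of_forall fun x => ?_) hlog hi0 hi1
    have := mul_sub_exp_le_mul_log (density_nonneg μ x) (-1 * ‖x‖ ^ 2)
    simpa using this
  unfold Ent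
  rw [if_pos ⟨hac, hint⟩, EReal.coe_le_coe_iff]
  refine (integral_mono_ae hint hi1 hlog).trans ?_
  rw [integral_density_mul hac]
  simp

/-- The uniform distribution on the unit ball. -/
noncomputable def unif (d : ℕ) : Measure (Eucl d) :=
  ProbabilityTheory.cond volume (Metric.ball (0 : Eucl d) 1)

theorem volume_ball_pos : 0 < volume (Metric.ball (0 : Eucl d) 1) :=
  Metric.measure_ball_pos _ _ one_pos

instance : IsProbabilityMeasure (unif d) :=
  ProbabilityTheory.cond_isProbabilityMeasure_of_finite volume_ball_pos.ne' measure_ball_lt_top.ne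

theorem ae_norm_le_unif : ∀ᵐ u ∂unif d, ‖u‖ ≤ 1 := by
  have h : unif d ≪ volume.restrict (Metric.ball (0 : Eucl d) 1) :=
    Measure.smul_absolutelyContinuous
  refine h.ae_le ((ae_restrict_iff' measurableSet_ball).2 (Eventually.of_forall fun u hu => ?_))
  exact (mem_ball_zero_iff.1 hu).le

theorem unif_apply_le (s : Set (Eucl d)) :
    unif d s ≤ (volume (Metric.ball (0 : Eucl d) 1))⁻¹ * volume s := by
  change ((volume (Metric.ball (0 : Eucl d) 1))⁻¹ • volume.restrict (Metric.ball (0 : Eucl d) 1)) s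
    ≤ _
  rw [Measure.smul_apply, smul_eq_mul]
  gcongr
  exact Measure.restrict_le_self

theorem measurable_add_smul (t : ℝ) :
    Measurable fun p : Eucl d × Eucl d => p.1 + t • p.2 := by fun_prop

theorem ae_norm_snd_le (μ : P2 d) : ∀ᵐ p ∂(μ.toMeasure.prod (unif d)), ‖p.2‖ ≤ 1 :=
  Measure.quasiMeasurePreserving_snd.ae ae_norm_le_unif

theorem integrable_norm_add_smul_sq (μ : P2 d) (t : ℝ) :
    Integrable (fun p : Eucl d × Eucl d => ‖p.1 + t • p.2‖ ^ 2) (μ.toMeasure.prod (unif d)) := by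
  have h1 : Integrable (fun p : Eucl d × Eucl d => 2 * ‖p.1‖ ^ 2 + 2 * t ^ 2)
      (μ.toMeasure.prod (unif d)) :=
    ((μ.integrable_sq_norm.comp_fst (unif d)).const_mul 2).add (integrable_const _)
  refine h1.mono' (by fun_prop) ?_
  filter_upwards [ae_norm_snd_le μ] with p hp
  rw [Real.norm_eq_abs, abs_of_nonneg (by positivity)]
  have h2 : ‖p.1 + t • p.2‖ ≤ ‖p.1‖ + |t| := by
    refine (norm_add_le _ _).trans ?_
    rw [norm_smul, Real.norm_eq_abs]
    nlinarith [abs_nonneg t]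
  have h3 : ‖p.1 + t • p.2‖ ^ 2 ≤ (‖p.1‖ + |t|) ^ 2 := by gcongr
  nlinarith [sq_nonneg (‖p.1‖ - |t|), sq_abs t]

/-- The law of `X + t U`, where `X` has law `μ` and `U` is independent of `X` and uniformly
distributed on the unit ball. -/
noncomputable def P2.smooth (μ : P2 d) (t : ℝ) : P2 d :=
  ⟨⟨(μ.toMeasure.prod (unif d)).map fun p => p.1 + t • p.2,
    Measure.isProbabilityMeasure_map (measurable_add_smul t).aemeasurable⟩,
    (integrable_map_measure (by fun_prop) (measurable_add_smul t).aemeasurable).2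
      (integrable_norm_add_smul_sq μ t)⟩

theorem P2.integral_smooth (μ : P2 d) (t : ℝ) {φ : Eucl d → ℝ} (hφ : Continuous φ) :
    ∫ x, φ x ∂(μ.smooth t).toMeasure
      = ∫ p, φ (p.1 + t • p.2) ∂(μ.toMeasure.prod (unif d)) :=
  integral_map (measurable_add_smul t).aemeasurable hφ.aestronglyMeasurable

theorem tendsto_smooth (μ : P2 d) {t : ℕ → ℝ} (ht : Tendsto t atTop (𝓝 0)) :
    Tendsto (fun n => μ.smooth (t n)) atTop (𝓝 μ) := by
  rw [tendsto_subtype_rng]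
  refine ProbabilityMeasure.tendsto_iff_forall_integral_tendsto.2 fun φ => ?_
  have h0 : ∫ x, φ x ∂(μ.1 : Measure (Eucl d))
      = ∫ p, φ p.1 ∂(μ.toMeasure.prod (unif d)) := by
    rw [integral_fun_fst (μ := μ.toMeasure) (ν := unif d) (fun x => φ x)]
    simp [P2.toMeasure]
  have h1 : ∀ n, ∫ x, φ x ∂((μ.smooth (t n)).1 : Measure (Eucl d))
      = ∫ p, φ (p.1 + t n • p.2) ∂(μ.toMeasure.prod (unif d)) := fun n =>
    P2.integral_smooth μ (t n) φ.continuous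
  simp_rw [h1, h0]
  refine tendsto_integral_of_dominated_convergence (fun _ => ‖φ‖)
    (fun n => (by fun_prop : Continuous fun p : Eucl d × Eucl d =>
      φ (p.1 + t n • p.2)).aestronglyMeasurable) (integrable_const _)
    (fun n => Eventually.of_forall fun p => φ.norm_coe_le_norm _) (Eventually.of_forall fun p => ?_)
  refine (φ.continuous.tendsto _).comp ?_
  simpa using (ht.smul_const p.2).const_add p.1

theorem tendsto_secondMoment_smooth (μ : P2 d) {t : ℕ → ℝ} (ht : Tendsto t atTop (𝓝 0)) :
    Tendsto (fun n => secondMoment (μ.smooth (t n))) atTop (𝓝 (secondMoment μ)) := by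
  have h0 : secondMoment μ = ∫ p, ‖p.1‖ ^ 2 ∂(μ.toMeasure.prod (unif d)) := by
    rw [integral_fun_fst (μ := μ.toMeasure) (ν := unif d) (fun x => ‖x‖ ^ 2)]
    simp [secondMoment]
  have h1 : ∀ n, secondMoment (μ.smooth (t n))
      = ∫ p, ‖p.1 + t n • p.2‖ ^ 2 ∂(μ.toMeasure.prod (unif d)) := fun n =>
    P2.integral_smooth μ (t n) (by fun_prop)
  simp_rw [h1, h0]
  refine tendsto_integral_filter_of_dominated_convergence (fun p => 2 * ‖p.1‖ ^ 2 + 2)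
    (Eventually.of_forall fun n => (integrable_norm_add_smul_sq μ (t n)).aestronglyMeasurable) ?_
    (((μ.integrable_sq_norm.comp_fst (unif d)).const_mul 2).add (integrable_const _))
    (Eventually.of_forall fun p => ?_)
  · have hone : ∀ᶠ n in atTop, |t n| ≤ 1 := by
      have := ht.abs
      rw [abs_zero] at this
      exact this.eventually_le_const one_pos
    filter_upwards [hone] with n hn
    filter_upwards [ae_norm_snd_le μ] with p hp
    rw [Real.norm_eq_abs, abs_of_nonneg (by positivity)]
    have h2 : ‖p.1 + t n • p.2‖ ≤ ‖p.1‖ + 1 := by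
      refine (norm_add_le _ _).trans ?_
      rw [norm_smul, Real.norm_eq_abs]
      nlinarith [abs_nonneg (t n), norm_nonneg p.2]
    have h3 : ‖p.1 + t n • p.2‖ ^ 2 ≤ (‖p.1‖ + 1) ^ 2 := by gcongr
    nlinarith [sq_nonneg (‖p.1‖ - 1)]
  · have : Tendsto (fun n => p.1 + t n • p.2) atTop (𝓝 p.1) := by
      simpa using (ht.smul_const p.2).const_add p.1
    exact this.norm.pow 2

/-- Whatever `μ` is, the law of `X + tU` has density at most `1 / (|B| tᵈ)`, with `|B|` the volume
of the unit ball; hence `K = -log |B|`. -/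
theorem ent_smooth_le (d : ℕ) : ∃ K : ℝ, ∀ (μ : P2 d) (t : ℝ), 0 < t →
    Ent (μ.smooth t) ≤ ((K - d * Real.log t : ℝ) : EReal) := by
  set v : ENNReal := (volume (Metric.ball (0 : Eucl d) 1))⁻¹ with hv
  have hvtop : v ≠ ⊤ := by simp [hv, volume_ball_pos.ne']
  have hv0 : v ≠ 0 := by simp [hv, measure_ball_lt_top.ne]
  have hvpos : 0 < v.toReal := ENNReal.toReal_pos hv0 hvtop
  refine ⟨Real.log v.toReal, fun μ t ht => ?_⟩
  have hlog : Real.log v.toReal - d * Real.log t = Real.log (v.toReal * (t ^ d)⁻¹) := by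
    rw [Real.log_mul hvpos.ne' (by positivity), Real.log_inv, Real.log_pow]; ring
  rw [hlog]
  refine ent_le_log_of_le_smul _ (by positivity) (Measure.le_iff.2 fun s hs => ?_)
  change ((μ.toMeasure.prod (unif d)).map fun p => p.1 + t • p.2) s ≤ _
  rw [Measure.map_apply (measurable_add_smul t) hs,
    Measure.prod_apply (measurable_add_smul t hs), Measure.smul_apply, smul_eq_mul]
  have hpt : ∀ x : Eucl d, unif d (Prod.mk x ⁻¹' ((fun p : Eucl d × Eucl d => p.1 + t • p.2) ⁻¹' s))
      ≤ ENNReal.ofReal (v.toReal * (t ^ d)⁻¹) * volume s := by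
    intro x
    refine (unif_apply_le _).trans ?_
    have hset : Prod.mk x ⁻¹' ((fun p : Eucl d × Eucl d => p.1 + t • p.2) ⁻¹' s)
        = (fun u : Eucl d => t • u) ⁻¹' ((fun y => x + y) ⁻¹' s) := rfl
    rw [hset, Measure.addHaar_preimage_smul _ ht.ne', measure_preimage_add, finrank_euclideanSpace,
      Fintype.card_fin, ← mul_assoc, ENNReal.ofReal_mul hvpos.le, ENNReal.ofReal_toReal hvtop,
      abs_of_pos (by positivity)]
  refine (lintegral_mono hpt).trans ?_
  simp

/-- Every measure is approximated, with its second moment, by measures whose entropy grows more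
slowly than `1 / σ n`. -/
theorem exists_recovery (μ : P2 d) {σ : ℕ → ℝ} (hσ : ∀ n, 0 < σ n)
    (hσ0 : Tendsto σ atTop (𝓝 0)) :
    ∃ (u : ℕ → P2 d) (e : ℕ → ℝ), Tendsto u atTop (𝓝 μ) ∧
      Tendsto (fun n => secondMoment (u n)) atTop (𝓝 (secondMoment μ)) ∧
      (∀ n, Ent (u n) ≤ (e n : EReal)) ∧ Tendsto (fun n => σ n * e n) atTop (𝓝 0) := by
  obtain ⟨K, hK⟩ := ent_smooth_le d
  have hsqrt : Tendsto (fun n => √(σ n)) atTop (𝓝 0) := by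
    have h := (Real.continuous_sqrt.tendsto 0).comp hσ0
    rwa [Real.sqrt_zero] at h
  have hinv : Tendsto (fun n => (√(σ n))⁻¹) atTop atTop :=
    tendsto_inv_nhdsGT_zero.comp (tendsto_nhdsWithin_iff.2
      ⟨hsqrt, Eventually.of_forall fun n => Real.sqrt_pos.2 (hσ n)⟩)
  have ht : Tendsto (fun n => Real.exp (-(√(σ n))⁻¹)) atTop (𝓝 0) :=
    Real.tendsto_exp_neg_atTop_nhds_zero.comp hinv
  -- With radius `exp (-1/√σ)` the entropy is at most `K + d/√σ`, and multiplying by `σ` leaves `σK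
  -- + d√σ → 0`.
  refine ⟨fun n => μ.smooth (Real.exp (-(√(σ n))⁻¹)), fun n => K + d * (√(σ n))⁻¹,
    tendsto_smooth μ ht, tendsto_secondMoment_smooth μ ht, fun n => ?_, ?_⟩
  · refine (hK μ _ (Real.exp_pos _)).trans (EReal.coe_le_coe_iff.2 ?_)
    rw [Real.log_exp]; linarith
  · have h := (hσ0.mul_const K).add (hsqrt.const_mul (d : ℝ))
    simp only [zero_mul, mul_zero, add_zero] at h
    refine h.congr fun n => ?_
    have hs : √(σ n) ≠ 0 := (Real.sqrt_pos.2 (hσ n)).ne'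
    nth_rw 1 3 [← Real.mul_self_sqrt (hσ n).le]
    field_simp

theorem exists_ent_le (d : ℕ) : ∃ (μ : P2 d) (e : ℝ), Ent μ ≤ (e : EReal) := by
  obtain ⟨K, hK⟩ := ent_smooth_le d
  let μ₀ : P2 d := ⟨⟨Measure.dirac 0, inferInstance⟩, by
    exact integrable_dirac (by simp)⟩
  exact ⟨μ₀.smooth 1, _, hK μ₀ 1 one_pos⟩

/-! ### Extended real arithmetic and an `L²` inequality -/

theorem add_coe_mul_le {b σ e : ℝ} (hσ : 0 ≤ σ) {E : EReal} (h : E ≤ e) :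
    (b : EReal) + (σ : EReal) * E ≤ ((b + σ * e : ℝ) : EReal) := by
  rw [EReal.coe_add, EReal.coe_mul]
  exact add_le_add_right (mul_le_mul_of_nonneg_left h (EReal.coe_nonneg.2 hσ)) _

theorem le_add_coe_mul {b σ e : ℝ} (hσ : 0 ≤ σ) {E : EReal} (h : e ≤ E) :
    ((b + σ * e : ℝ) : EReal) ≤ (b : EReal) + (σ : EReal) * E := by
  rw [EReal.coe_add, EReal.coe_mul]
  exact add_le_add_right (mul_le_mul_of_nonneg_left h (EReal.coe_nonneg.2 hσ)) _

/-- Strict positivity of `σ` is essential: `0 * ⊤ = 0` would hide an infinite entropy. -/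
theorem exists_coe_of_add_coe_mul_le {b σ c : ℝ} (hσ : 0 < σ) {E : EReal} (hE : E ≠ ⊥)
    (h : (b : EReal) + (σ : EReal) * E ≤ (c : EReal)) : ∃ e : ℝ, E = e ∧ b + σ * e ≤ c := by
  induction E with
  | bot => exact absurd rfl hE
  | top =>
    rw [EReal.coe_mul_top_of_pos hσ, EReal.coe_add_top, top_le_iff] at h
    exact absurd h (EReal.coe_ne_top c)
  | coe e => exact ⟨e, rfl, by exact_mod_cast h⟩

theorem integrable_of_ae_abs_le {α : Type*} [MeasurableSpace α] {ν : Measure α} [IsFiniteMeasure ν]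
    {f : α → ℝ} (hf : Measurable f) {N : ℝ} (hN : ∀ᵐ x ∂ν, |f x| ≤ N) : Integrable f ν :=
  (integrable_const N).mono' hf.aestronglyMeasurable hN

/-- The variance of `|f|` is nonnegative. -/
theorem integral_abs_le_sqrt {α : Type*} [MeasurableSpace α] {ν : Measure α}
    [IsProbabilityMeasure ν] {f : α → ℝ} (hf : Measurable f) {N : ℝ} (hN : ∀ x, |f x| ≤ N) :
    ∫ x, |f x| ∂ν ≤ √(∫ x, f x ^ 2 ∂ν) := by
  refine Real.le_sqrt_of_sq_le ?_
  have h1 : Integrable (fun x => |f x|) ν := (integrable_of_ae_abs_le hf (.of_forall hN)).abs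
  have h2 : Integrable (fun x => f x ^ 2) ν := by
    refine integrable_of_ae_abs_le (hf.pow_const 2) (N := N ^ 2) (.of_forall fun x => ?_)
    rw [abs_pow]
    exact pow_le_pow_left₀ (abs_nonneg _) (hN x) 2
  set c := ∫ x, |f x| ∂ν with hc
  have h3 : 0 ≤ ∫ x, (f x ^ 2 - 2 * c * |f x| + c ^ 2) ∂ν := integral_nonneg fun x => by
    have : f x ^ 2 - 2 * c * |f x| + c ^ 2 = (|f x| - c) ^ 2 := by rw [← sq_abs (f x)]; ring
    simp only [Pi.zero_apply, this]
    positivity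
  rw [integral_add (by exact h2.sub (h1.const_mul _)) (integrable_const _),
    integral_sub h2 (h1.const_mul _), integral_const_mul, ← hc] at h3
  simp only [integral_const, probReal_univ, one_smul] at h3
  nlinarith

/-! ### Network outputs -/

section Net

variable {U : Type*} [MeasurableSpace U] {d : ℕ} {Ψ : U → Eucl d → ℝ} {R : ℝ}

theorem BoundedSmooth.continuous (h : BoundedSmooth Ψ R) (u : U) : Continuous (Ψ u) :=
  (h.differentiable u).continuous

theorem BoundedSmooth.measurable_net (h : BoundedSmooth Ψ R) (μ : P2 d) : Measurable (net Ψ μ) := by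
  -- Carathéodory functions (continuous in `θ`, measurable in `u`) are jointly measurable.
  have h1 : Measurable (Function.uncurry fun (θ : Eucl d) (u : U) => Ψ u θ) :=
    measurable_uncurry_of_continuous_of_measurable h.continuous h.measurable_input
  exact (h1.stronglyMeasurable.integral_prod_left (μ := μ.toMeasure)).measurable

theorem BoundedSmooth.integrable (h : BoundedSmooth Ψ R) (μ : P2 d) (u : U) :
    Integrable (Ψ u) μ.toMeasure :=
  integrable_of_abs_le μ (h.continuous u).measurable (h.abs_le u)

theorem BoundedSmooth.abs_net_le (h : BoundedSmooth Ψ R) (μ : P2 d) (u : U) : |net Ψ μ u| ≤ R := by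
  have := norm_integral_le_of_norm_le_const (μ := μ.toMeasure) (f := Ψ u) (C := R)
    (.of_forall (h.abs_le u))
  simpa [net] using this

theorem BoundedSmooth.abs_net_sub_le (h : BoundedSmooth Ψ R) (μ ν : P2 d) (u : U) :
    |net Ψ μ u - net Ψ ν u| ≤ R + R :=
  (abs_sub _ _).trans (add_le_add (h.abs_net_le _ _) (h.abs_net_le _ _))

theorem BoundedSmooth.net_mid (h : BoundedSmooth Ψ R) (μ ν : P2 d) (u : U) :
    net Ψ (P2.mid μ ν) u = (net Ψ μ u + net Ψ ν u) / 2 :=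
  P2.integral_mid μ ν (h.integrable μ u) (h.integrable ν u)

theorem BoundedSmooth.tendsto_net (h : BoundedSmooth Ψ R) {ι : Type*} {l : Filter ι} {v : ι → P2 d}
    {μ : P2 d} (hv : Tendsto v l (𝓝 μ)) (u : U) :
    Tendsto (fun i => net Ψ (v i) u) l (𝓝 (net Ψ μ u)) :=
  P2.tendsto_integral hv (h.continuous u) (h.abs_le u)

end Net

/-! ### Stage I: convexity, existence and stability -/

section Objectives

variable {A W : Type*} [MeasurableSpace A] [MeasurableSpace W] {dx dz : ℕ}
  {ρ : Measure (A × ℝ × W)} {ΨA : A → Eucl dx → ℝ} {ΨW : W → Eucl dz → ℝ} {M R ζ₁ : ℝ}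

theorem U₁_nonneg (μx : P2 dx) (μz : P2 dz) : 0 ≤ U₁ ρ ΨA ΨW μx μz :=
  mul_nonneg (by norm_num) (integral_nonneg fun _ => sq_nonneg _)

theorem U₂_nonneg (μz : P2 dz) : 0 ≤ U₂ ρ ΨW μz :=
  mul_nonneg (by norm_num) (integral_nonneg fun _ => sq_nonneg _)

theorem stageI_zero (μx : P2 dx) (μz : P2 dz) : stageI ρ ΨA ΨW ζ₁ 0 μx μz
    = ((U₁ ρ ΨA ΨW μx μz + ζ₁ / 2 * secondMoment μz : ℝ) : EReal) := by
  simp [stageI]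

theorem stageI_ne_bot {σ : ℝ} (hσ : 0 ≤ σ) (μx : P2 dx) (μz : P2 dz) :
    stageI ρ ΨA ΨW ζ₁ σ μx μz ≠ ⊥ := by
  refine ne_bot_of_le_ne_bot (EReal.coe_ne_bot _)
    (le_add_coe_mul hσ (neg_secondMoment_le_ent μz one_pos))

theorem IsStageISolution.exists_coe {σ : ℝ} (hσ : 0 ≤ σ) {μx : P2 dx} {μz : P2 dz}
    (hs : IsStageISolution ρ ΨA ΨW ζ₁ σ μx μz) :
    ∃ v : ℝ, stageI ρ ΨA ΨW ζ₁ σ μx μz = (v : EReal) := by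
  obtain ⟨ν, e, he⟩ := exists_ent_le dz
  have h : stageI ρ ΨA ΨW ζ₁ σ μx μz < ⊤ :=
    ((hs ν).trans (add_coe_mul_le hσ he)).trans_lt (EReal.coe_lt_top _)
  exact ⟨_, (EReal.coe_toReal h.ne (stageI_ne_bot hσ μx μz)).symm⟩

/-- Coercivity for the direct method. -/
theorem secondMoment_le_of_stageI_le (hζ : 0 < ζ₁) {σ : ℝ} (hσ : 0 ≤ σ) (c : ℝ) :
    ∃ C : ℝ, ∀ (μx : P2 dx) (μz : P2 dz), stageI ρ ΨA ΨW ζ₁ σ μx μz ≤ (c : EReal) →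
      secondMoment μz ≤ C := by
  rcases hσ.eq_or_lt with rfl | hσ
  · refine ⟨2 / ζ₁ * c, fun μx μz h => ?_⟩
    rw [stageI_zero, EReal.coe_le_coe_iff] at h
    have := U₁_nonneg (ρ := ρ) (ΨA := ΨA) (ΨW := ΨW) μx μz
    rw [div_mul_eq_mul_div, le_div_iff₀ hζ]
    linarith
  · have ha : 0 < ζ₁ / (4 * σ) := by positivity
    refine ⟨4 / ζ₁ * (c + σ * entConj (ζ₁ / (4 * σ)) (0 : Eucl dz → ℝ)), fun μx μz h => ?_⟩
    have h1 := EReal.coe_le_coe_iff.1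
      ((le_add_coe_mul hσ.le (neg_secondMoment_le_ent μz ha)).trans h)
    have := U₁_nonneg (ρ := ρ) (ΨA := ΨA) (ΨW := ΨW) μx μz
    have h2 : σ * (-(ζ₁ / (4 * σ) * secondMoment μz) - entConj (ζ₁ / (4 * σ)) (0 : Eucl dz → ℝ))
        = -(ζ₁ / 4 * secondMoment μz) - σ * entConj (ζ₁ / (4 * σ)) (0 : Eucl dz → ℝ) := by
      field_simp
    rw [h2] at h1
    rw [div_mul_eq_mul_div, le_div_iff₀ hζ]
    linarith

variable [IsProbabilityMeasure ρ]

theorem measurable_net_fst (hA : BoundedSmooth ΨA R) (μx : P2 dx) :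
    Measurable fun t : A × ℝ × W => net ΨA μx t.1 :=
  (hA.measurable_net μx).comp measurable_fst

theorem measurable_net_snd (hW : BoundedSmooth ΨW R) (μz : P2 dz) :
    Measurable fun t : A × ℝ × W => net ΨW μz t.2.2 :=
  (hW.measurable_net μz).comp measurable_snd.snd

theorem sq_le_of_abs_le {x N : ℝ} (h : |x| ≤ N) : |x ^ 2| ≤ N ^ 2 := by
  rw [abs_pow]; exact pow_le_pow_left₀ (abs_nonneg _) h 2

theorem abs_net_sub_net_le (hA : BoundedSmooth ΨA R) (hW : BoundedSmooth ΨW R) (μx : P2 dx)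
    (μz : P2 dz) (t : A × ℝ × W) : |net ΨW μz t.2.2 - net ΨA μx t.1| ≤ R + R :=
  (abs_sub _ _).trans (add_le_add (hW.abs_net_le _ _) (hA.abs_net_le _ _))

theorem integrable_sq_net_sub_net (hA : BoundedSmooth ΨA R) (hW : BoundedSmooth ΨW R) (μx : P2 dx)
    (μz : P2 dz) : Integrable (fun t => (net ΨW μz t.2.2 - net ΨA μx t.1) ^ 2) ρ :=
  integrable_of_ae_abs_le
    (((measurable_net_snd hW μz).sub (measurable_net_fst hA μx)).pow_const 2)
    (.of_forall fun t => sq_le_of_abs_le (abs_net_sub_net_le hA hW μx μz t))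

theorem tendsto_U₁ (hA : BoundedSmooth ΨA R) (hW : BoundedSmooth ΨW R) {ι : Type*} {l : Filter ι}
    [l.IsCountablyGenerated] {u : ι → P2 dx} {v : ι → P2 dz} {μx : P2 dx} {μz : P2 dz}
    (hu : Tendsto u l (𝓝 μx)) (hv : Tendsto v l (𝓝 μz)) :
    Tendsto (fun i => U₁ ρ ΨA ΨW (u i) (v i)) l (𝓝 (U₁ ρ ΨA ΨW μx μz)) := by
  refine Tendsto.const_mul _ (tendsto_integral_filter_of_dominated_convergence
    (fun _ => (R + R) ^ 2)
    (.of_forall fun i => (integrable_sq_net_sub_net hA hW (u i) (v i)).aestronglyMeasurable)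
    (.of_forall fun i => .of_forall fun t =>
      sq_le_of_abs_le (abs_net_sub_net_le hA hW (u i) (v i) t))
    (integrable_const _) (.of_forall fun t => ?_))
  exact ((hW.tendsto_net hv _).sub (hA.tendsto_net hu _)).pow 2

/-- Dominated convergence along `𝓝 μ` requires a countably generated filter. -/
instance (d : ℕ) : FirstCountableTopology (P2 d) :=
  (show Topology.IsInducing (Subtype.val : P2 d → ProbabilityMeasure (Eucl d)) from
    ⟨rfl⟩).firstCountableTopology

theorem continuous_U₁ (hA : BoundedSmooth ΨA R) (hW : BoundedSmooth ΨW R) (μx : P2 dx) :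
    Continuous fun μz : P2 dz => U₁ ρ ΨA ΨW μx μz :=
  continuous_iff_continuousAt.2 fun _ => tendsto_U₁ hA hW tendsto_const_nhds tendsto_id

theorem integrable_abs_net_sub (hA : BoundedSmooth ΨA R) (μx μx' : P2 dx) :
    Integrable (fun t => |net ΨA μx t.1 - net ΨA μx' t.1|) ρ :=
  (integrable_of_ae_abs_le ((measurable_net_fst hA μx).sub (measurable_net_fst hA μx'))
    (.of_forall fun t => hA.abs_net_sub_le μx μx' t.1)).abs

theorem tendsto_integral_abs_net_sub (hA : BoundedSmooth ΨA R) {u : ℕ → P2 dx} {μx : P2 dx}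
    (hu : Tendsto u atTop (𝓝 μx)) :
    Tendsto (fun n => ∫ t, |net ΨA (u n) t.1 - net ΨA μx t.1| ∂ρ) atTop (𝓝 0) := by
  have h := tendsto_integral_of_dominated_convergence (μ := ρ)
    (F := fun n t => |net ΨA (u n) t.1 - net ΨA μx t.1|) (f := fun _ => 0) (fun _ => R + R)
    (fun n => (integrable_abs_net_sub hA (u n) μx).aestronglyMeasurable) (integrable_const _)
    (fun n => .of_forall fun t => by
      rw [Real.norm_eq_abs, abs_abs]
      exact hA.abs_net_sub_le _ _ _)
    (.of_forall fun t => by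
      simpa using ((hA.tendsto_net hu t.1).sub_const (net ΨA μx t.1)).abs)
  simpa using h

/-- The error does not depend on `μz`, so `μx` can be perturbed without control of the Stage I
solutions. The integrands differ by `(q - p)(q + p)` with `|q + p| ≤ 4R`. -/
theorem U₁_le_add (hA : BoundedSmooth ΨA R) (hW : BoundedSmooth ΨW R) (μx μx' : P2 dx)
    (μz : P2 dz) : U₁ ρ ΨA ΨW μx' μz ≤ U₁ ρ ΨA ΨW μx μz
      + 2 * R * ∫ t, |net ΨA μx t.1 - net ΨA μx' t.1| ∂ρ := by
  have h : ∫ t, (net ΨW μz t.2.2 - net ΨA μx' t.1) ^ 2 ∂ρ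
      ≤ ∫ t, ((net ΨW μz t.2.2 - net ΨA μx t.1) ^ 2
        + 4 * R * |net ΨA μx t.1 - net ΨA μx' t.1|) ∂ρ := by
    refine integral_mono (integrable_sq_net_sub_net hA hW μx' μz)
      ((integrable_sq_net_sub_net hA hW μx μz).add
        ((integrable_abs_net_sub hA μx μx').const_mul _)) fun t => ?_
    have h1 := abs_net_sub_net_le hA hW μx μz t
    have h2 := abs_net_sub_net_le hA hW μx' μz t
    set p := net ΨW μz t.2.2 - net ΨA μx t.1
    set q := net ΨW μz t.2.2 - net ΨA μx' t.1
    have hpq : net ΨA μx t.1 - net ΨA μx' t.1 = q - p := by simp only [p, q]; ring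
    simp only [hpq]
    have h3 : (q - p) * (q + p) ≤ |q - p| * (4 * R) := by
      refine (le_abs_self _).trans ?_
      rw [abs_mul]
      refine mul_le_mul_of_nonneg_left ((abs_add_le _ _).trans ?_) (abs_nonneg _)
      linarith
    nlinarith
  rw [integral_add (integrable_sq_net_sub_net hA hW μx μz)
    ((integrable_abs_net_sub hA μx μx').const_mul _), integral_const_mul] at h
  unfold U₁
  linarith

/-- Parallelogram identity; its last term is the source of strong convexity. -/
theorem U₁_mid (hA : BoundedSmooth ΨA R) (hW : BoundedSmooth ΨW R) (μx : P2 dx) (μz μz' : P2 dz) :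
    U₁ ρ ΨA ΨW μx (P2.mid μz μz') = (U₁ ρ ΨA ΨW μx μz + U₁ ρ ΨA ΨW μx μz') / 2
      - 1 / 8 * ∫ t, (net ΨW μz t.2.2 - net ΨW μz' t.2.2) ^ 2 ∂ρ := by
  have hi1 := integrable_sq_net_sub_net (ρ := ρ) hA hW μx μz
  have hi2 := integrable_sq_net_sub_net (ρ := ρ) hA hW μx μz'
  have hi3 : Integrable (fun t => (net ΨW μz t.2.2 - net ΨW μz' t.2.2) ^ 2) ρ :=
    integrable_of_ae_abs_le
      (((measurable_net_snd hW μz).sub (measurable_net_snd hW μz')).pow_const 2)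
      (.of_forall fun t => sq_le_of_abs_le (hW.abs_net_sub_le μz μz' t.2.2))
  have h : ∀ t : A × ℝ × W, (net ΨW (P2.mid μz μz') t.2.2 - net ΨA μx t.1) ^ 2
      = 1 / 2 * (net ΨW μz t.2.2 - net ΨA μx t.1) ^ 2
        + 1 / 2 * (net ΨW μz' t.2.2 - net ΨA μx t.1) ^ 2
        - 1 / 4 * (net ΨW μz t.2.2 - net ΨW μz' t.2.2) ^ 2 := fun t => by
    rw [hW.net_mid]; ring
  unfold U₁
  simp_rw [h]
  rw [integral_sub (by exact (hi1.const_mul _).add (hi2.const_mul _)) (hi3.const_mul _),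
    integral_add (hi1.const_mul _) (hi2.const_mul _), integral_const_mul, integral_const_mul,
    integral_const_mul]
  ring

/-- A difference of squares bounds the change by the `L¹(ρ)` distance of the outputs, hence by the
`L²(ρ)` distance. -/
theorem abs_U₂_sub_le (hM : ∀ᵐ t ∂ρ, |t.2.1| ≤ M) (hW : BoundedSmooth ΨW R) (μz μz' : P2 dz) :
    |U₂ ρ ΨW μz - U₂ ρ ΨW μz'|
      ≤ (R + M) * √(∫ t, (net ΨW μz t.2.2 - net ΨW μz' t.2.2) ^ 2 ∂ρ) := by
  have hb : ∀ ν : P2 dz, ∀ᵐ t ∂ρ, |net ΨW ν t.2.2 - t.2.1| ≤ R + M := fun ν => by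
    filter_upwards [hM] with t ht
    exact (abs_sub _ _).trans (add_le_add (hW.abs_net_le _ _) ht)
  have hi : ∀ ν : P2 dz, Integrable (fun t => (net ΨW ν t.2.2 - t.2.1) ^ 2) ρ := fun ν => by
    refine integrable_of_ae_abs_le
      (((measurable_net_snd hW ν).sub measurable_snd.fst).pow_const 2) (N := (R + M) ^ 2) ?_
    filter_upwards [hb ν] with t ht using sq_le_of_abs_le ht
  have hdm := (measurable_net_snd (A := A) hW μz).sub (measurable_net_snd hW μz')
  have hRM : 0 ≤ R + M := by
    obtain ⟨t, ht⟩ := (hb μz).exists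
    exact (abs_nonneg _).trans ht
  have hint : Integrable (fun t => |net ΨW μz t.2.2 - net ΨW μz' t.2.2|) ρ :=
    (integrable_of_ae_abs_le hdm (.of_forall fun t => hW.abs_net_sub_le μz μz' t.2.2)).abs
  have h1 : |∫ t, (net ΨW μz t.2.2 - t.2.1) ^ 2 ∂ρ - ∫ t, (net ΨW μz' t.2.2 - t.2.1) ^ 2 ∂ρ|
      ≤ 2 * (R + M) * ∫ t, |net ΨW μz t.2.2 - net ΨW μz' t.2.2| ∂ρ := by
    rw [← integral_sub (hi μz) (hi μz'), ← integral_const_mul]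
    refine norm_integral_le_of_norm_le (G := ℝ) (hint.const_mul _) ?_
    filter_upwards [hb μz, hb μz'] with t h1 h2
    rw [Real.norm_eq_abs]
    have : (net ΨW μz t.2.2 - t.2.1) ^ 2 - (net ΨW μz' t.2.2 - t.2.1) ^ 2
        = ((net ΨW μz t.2.2 - t.2.1) + (net ΨW μz' t.2.2 - t.2.1))
          * (net ΨW μz t.2.2 - net ΨW μz' t.2.2) := by ring
    rw [this, abs_mul]
    refine mul_le_mul_of_nonneg_right ((abs_add_le _ _).trans ?_) (abs_nonneg _)
    linarith
  have h2 := integral_abs_le_sqrt (ν := ρ) hdm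
    fun t => hW.abs_net_sub_le μz μz' t.2.2
  have h3 := mul_le_mul_of_nonneg_left h2 hRM
  unfold U₂
  rw [← mul_sub, abs_mul, abs_of_pos (by norm_num : (0 : ℝ) < 1 / 2)]
  simp only [Pi.sub_apply] at h3
  linarith

/-- Strong midpoint convexity of the Stage I objective along the network outputs. -/
theorem stageI_mid_le (hA : BoundedSmooth ΨA R) (hW : BoundedSmooth ΨW R) {σ : ℝ} (hσ : 0 ≤ σ)
    (μx : P2 dx) {μz μz' : P2 dz} {c c' : ℝ} (h : stageI ρ ΨA ΨW ζ₁ σ μx μz ≤ (c : EReal))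
    (h' : stageI ρ ΨA ΨW ζ₁ σ μx μz' ≤ (c' : EReal)) :
    stageI ρ ΨA ΨW ζ₁ σ μx (P2.mid μz μz') ≤ (((c + c') / 2
      - 1 / 8 * ∫ t, (net ΨW μz t.2.2 - net ΨW μz' t.2.2) ^ 2 ∂ρ : ℝ) : EReal) := by
  unfold stageI at h h' ⊢
  rcases hσ.eq_or_lt with rfl | hσ
  · simp only [EReal.coe_zero, zero_mul, add_zero, EReal.coe_le_coe_iff] at h h' ⊢
    rw [U₁_mid hA hW, secondMoment_mid]
    linarith
  · obtain ⟨e, he, hc⟩ := exists_coe_of_add_coe_mul_le hσ (ent_ne_bot _) h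
    obtain ⟨e', he', hc'⟩ := exists_coe_of_add_coe_mul_le hσ (ent_ne_bot _) h'
    refine (add_coe_mul_le hσ.le (ent_mid_le he.le he'.le)).trans (EReal.coe_le_coe_iff.2 ?_)
    rw [U₁_mid hA hW, secondMoment_mid]
    linarith

/-- Quadratic growth of the Stage I objective around a minimizer. -/
theorem IsStageISolution.integral_sq_le (hA : BoundedSmooth ΨA R) (hW : BoundedSmooth ΨW R)
    {σ : ℝ} (hσ : 0 ≤ σ) {μx : P2 dx} {μz ν : P2 dz} {v δ : ℝ}
    (hs : IsStageISolution ρ ΨA ΨW ζ₁ σ μx μz)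
    (hv : stageI ρ ΨA ΨW ζ₁ σ μx μz = (v : EReal))
    (h : stageI ρ ΨA ΨW ζ₁ σ μx ν ≤ ((v + δ : ℝ) : EReal)) :
    ∫ t, (net ΨW ν t.2.2 - net ΨW μz t.2.2) ^ 2 ∂ρ ≤ 4 * δ := by
  -- The midpoint value lies between `v` and `v + δ/2` minus an eighth of the integral.
  have h1 := (hs (P2.mid ν μz)).trans (stageI_mid_le hA hW hσ μx h hv.le)
  rw [hv, EReal.coe_le_coe_iff] at h1
  linarith

/-- Quadratic growth with `δ = 0`: two solutions have `ρ`-a.e. equal outputs. -/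
theorem IsStageISolution.U₂_eq (hM : ∀ᵐ t ∂ρ, |t.2.1| ≤ M) (hA : BoundedSmooth ΨA R)
    (hW : BoundedSmooth ΨW R) {σ : ℝ} (hσ : 0 ≤ σ) {μx : P2 dx} {μz μz' : P2 dz}
    (hs : IsStageISolution ρ ΨA ΨW ζ₁ σ μx μz) (hs' : IsStageISolution ρ ΨA ΨW ζ₁ σ μx μz') :
    U₂ ρ ΨW μz = U₂ ρ ΨW μz' := by
  obtain ⟨v, hv⟩ := hs'.exists_coe hσ
  have h1 := hs'.integral_sq_le hA hW hσ (ν := μz) (δ := 0) hv (by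
    rw [add_zero, ← hv]; exact hs μz')
  have h2 := abs_U₂_sub_le hM hW μz μz'
  rw [Real.sqrt_eq_zero_of_nonpos (by linarith), mul_zero] at h2
  exact sub_eq_zero.1 (abs_eq_zero.1 (le_antisymm h2 (abs_nonneg _)))

/-- For `σ > 0`, half of the quadratic term is paired with the entropy, whose compensated form is
lower semicontinuous; the other half stays with `U₁`. -/
theorem lowerSemicontinuous_stageI (hA : BoundedSmooth ΨA R) (hW : BoundedSmooth ΨW R)
    (hζ : 0 < ζ₁) {σ : ℝ} (hσ : 0 ≤ σ) (μx : P2 dx) :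
    LowerSemicontinuous fun μz : P2 dz => stageI ρ ΨA ΨW ζ₁ σ μx μz := by
  have hreal : ∀ {c : ℝ}, 0 ≤ c → LowerSemicontinuous fun μz : P2 dz =>
      ((U₁ ρ ΨA ΨW μx μz + c * secondMoment μz : ℝ) : EReal) := fun {c} hc => by
    refine continuous_coe_real_ereal.comp_lowerSemicontinuous ?_ (fun _ _ h => by exact_mod_cast h)
    refine (continuous_U₁ hA hW μx).lowerSemicontinuous.add ?_
    exact (continuous_const_mul c).comp_lowerSemicontinuous lowerSemicontinuous_secondMoment
      (monotone_mul_left_of_nonneg hc)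
  rcases hσ.eq_or_lt with rfl | hσ
  · simp_rw [stageI_zero]
    exact hreal (by positivity)
  · have ha : 0 < ζ₁ / (4 * σ) := by positivity
    have heq : ∀ μz : P2 dz, stageI ρ ΨA ΨW ζ₁ σ μx μz
        = ((U₁ ρ ΨA ΨW μx μz + ζ₁ / 4 * secondMoment μz : ℝ) : EReal)
          + (σ : EReal) * (((ζ₁ / (4 * σ) * secondMoment μz : ℝ) : EReal) + Ent μz) := fun μz => by
      rw [EReal.left_distrib_of_nonneg_of_ne_top (EReal.coe_nonneg.2 hσ.le) (EReal.coe_ne_top σ),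
        ← add_assoc, ← EReal.coe_mul, ← EReal.coe_add, stageI]
      congr 2
      field_simp
      ring
    simp_rw [heq]
    refine (hreal (by positivity)).add' ?_ fun μz => EReal.continuousAt_add
      (Or.inl (EReal.coe_ne_top _)) (Or.inl (EReal.coe_ne_bot _))
    refine Continuous.comp_lowerSemicontinuous (g := fun x : EReal => (σ : EReal) * x) ?_
      (lowerSemicontinuous_secondMoment_add_ent ha) fun _ _ h =>
        mul_le_mul_of_nonneg_left h (EReal.coe_nonneg.2 hσ.le)
    have hσ' : (σ : EReal) ≠ 0 := EReal.coe_ne_zero.2 hσ.ne'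
    refine continuous_iff_continuousAt.2 fun x =>
      ContinuousAt.comp (f := fun x : EReal => ((σ : EReal), x)) (EReal.continuousAt_mul
        (.inl hσ') (.inl hσ') (.inl (EReal.coe_ne_bot σ)) (.inl (EReal.coe_ne_top σ))) (by fun_prop)

theorem exists_isStageISolution (hA : BoundedSmooth ΨA R) (hW : BoundedSmooth ΨW R)
    (hζ : 0 < ζ₁) {σ : ℝ} (hσ : 0 ≤ σ) (μx : P2 dx) :
    ∃ μz : P2 dz, IsStageISolution ρ ΨA ΨW ζ₁ σ μx μz := by
  obtain ⟨ν₀, e, he⟩ := exists_ent_le dz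
  have h0 := add_coe_mul_le (b := U₁ ρ ΨA ΨW μx ν₀ + ζ₁ / 2 * secondMoment ν₀) hσ he
  set c := U₁ ρ ΨA ΨW μx ν₀ + ζ₁ / 2 * secondMoment ν₀ + σ * e
  obtain ⟨C, hC⟩ := secondMoment_le_of_stageI_le (ρ := ρ) (ΨA := ΨA) (ΨW := ΨW) hζ hσ c
  obtain ⟨μz, -, hmin⟩ := ((lowerSemicontinuous_stageI (ρ := ρ) hA hW hζ hσ
    μx).lowerSemicontinuousOn _).exists_isMinOn ⟨ν₀, hC μx ν₀ h0⟩ (isCompact_secondMoment_le C)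
  refine ⟨μz, fun ν => ?_⟩
  -- Competitors above level `c` cannot beat `ν₀`; the others lie in the compact set.
  rcases le_or_gt (stageI ρ ΨA ΨW ζ₁ σ μx ν) (c : EReal) with h | h
  · exact hmin (hC μx ν h)
  · exact ((hmin (hC μx ν₀ h0)).trans h0).trans h.le

/-- Stability of the Stage II error under vanishing regularization and weak perturbation. -/
theorem tendsto_U₂_of_isStageISolution (hM : ∀ᵐ t ∂ρ, |t.2.1| ≤ M) (hA : BoundedSmooth ΨA R)
    (hW : BoundedSmooth ΨW R) (hζ : 0 < ζ₁) {σ : ℕ → ℝ} (hσ : ∀ n, 0 < σ n)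
    (hσ0 : Tendsto σ atTop (𝓝 0)) {μ : ℕ → P2 dx} {μ₀ : P2 dx} (hμ : Tendsto μ atTop (𝓝 μ₀))
    {ν : ℕ → P2 dz} {ν₀ : P2 dz} (hν : ∀ n, IsStageISolution ρ ΨA ΨW ζ₁ (σ n) (μ n) (ν n))
    (hν₀ : IsStageISolution ρ ΨA ΨW ζ₁ 0 μ₀ ν₀) :
    Tendsto (fun n => U₂ ρ ΨW (ν n)) atTop (𝓝 (U₂ ρ ΨW ν₀)) := by
  obtain ⟨u, e, hu, hum, hue, hse⟩ := exists_recovery ν₀ hσ hσ0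
  set v := U₁ ρ ΨA ΨW μ₀ ν₀ + ζ₁ / 2 * secondMoment ν₀ with hv
  set b : ℕ → ℝ := fun n => U₁ ρ ΨA ΨW (μ n) (u n) + ζ₁ / 2 * secondMoment (u n) + σ n * e n
  have hb : Tendsto b atTop (𝓝 v) := by
    have := ((tendsto_U₁ (ρ := ρ) hA hW hμ hu).add (hum.const_mul (ζ₁ / 2))).add hse
    rwa [add_zero] at this
  set K := entConj 1 (0 : Eucl dz → ℝ)
  set κ : ℕ → ℝ := fun n => 2 * R * ∫ t, |net ΨA (μ n) t.1 - net ΨA μ₀ t.1| ∂ρ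
  have hκ : Tendsto κ atTop (𝓝 0) := by
    simpa using (tendsto_integral_abs_net_sub (ρ := ρ) hA hμ).const_mul (2 * R)
  -- Excess of `ν n` in the unregularized problem at `μ₀`: `b n` bounds the regularized minimum, the
  -- terms with `σ n` pay for dropping the entropy (given the moment bound `hm`), and `κ n` for
  -- replacing `μ n` by `μ₀`.
  set δ : ℕ → ℝ := fun n => b n + σ n * K + κ n + σ n * (4 / ζ₁ * (b n + σ n * K)) - v
  have hδ : Tendsto δ atTop (𝓝 0) := by
    have h1 := hb.add (hσ0.mul_const K)
    have := ((h1.add hκ).add (hσ0.mul (h1.const_mul (4 / ζ₁)))).sub_const v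
    simpa using this
  have hD : ∀ᶠ n in atTop, |U₂ ρ ΨW (ν n) - U₂ ρ ΨW ν₀| ≤ (R + M) * √(4 * δ n) := by
    -- From here on the entropy uses at most half of the quadratic term.
    filter_upwards [hσ0.eventually_le_const (show (0 : ℝ) < ζ₁ / 4 by positivity)] with n hn
    have hle : stageI ρ ΨA ΨW ζ₁ (σ n) (μ n) (ν n) ≤ (b n : EReal) :=
      (hν n (u n)).trans (add_coe_mul_le (hσ n).le (hue n))
    have h1 := EReal.coe_le_coe_iff.1
      ((le_add_coe_mul (hσ n).le (neg_secondMoment_le_ent (ν n) one_pos)).trans hle)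
    have h2 := U₁_nonneg (ρ := ρ) (ΨA := ΨA) (ΨW := ΨW) (μ n) (ν n)
    have h3 := secondMoment_nonneg (ν n)
    have hm : secondMoment (ν n) ≤ 4 / ζ₁ * (b n + σ n * K) := by
      rw [div_mul_eq_mul_div, le_div_iff₀ hζ]
      nlinarith
    have h4 := U₁_le_add (ρ := ρ) hA hW (μ n) μ₀ (ν n)
    have h5 : stageI ρ ΨA ΨW ζ₁ 0 μ₀ (ν n) ≤ ((v + δ n : ℝ) : EReal) := by
      rw [stageI_zero, EReal.coe_le_coe_iff]
      have h6 := mul_le_mul_of_nonneg_left hm (hσ n).le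
      simp only [δ, κ]
      linarith
    have h7 := hν₀.integral_sq_le hA hW le_rfl (stageI_zero μ₀ ν₀) h5
    refine (abs_U₂_sub_le hM hW (ν n) ν₀).trans ?_
    refine mul_le_mul_of_nonneg_left (Real.sqrt_le_sqrt h7) ?_
    obtain ⟨t, ht⟩ := hM.exists
    exact add_nonneg ((abs_nonneg _).trans (hW.abs_net_le ν₀ t.2.2)) ((abs_nonneg _).trans ht)
  have hlim : Tendsto (fun n => (R + M) * √(4 * δ n)) atTop (𝓝 0) := by
    have := ((Real.continuous_sqrt.tendsto _).comp (hδ.const_mul 4)).const_mul (R + M)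
    simpa using this
  rw [tendsto_iff_norm_sub_tendsto_zero]
  exact tendsto_of_tendsto_of_tendsto_of_le_of_le' tendsto_const_nhds hlim
    (.of_forall fun _ => norm_nonneg _) hD

end Objectives

/-! ### Γ-convergence of Stage II and limits of minimizers -/

section Gamma

variable {A W : Type*} [MeasurableSpace A] [MeasurableSpace W] {dx dz : ℕ}
  {ρ : Measure (A × ℝ × W)} {ΨA : A → Eucl dx → ℝ} {ΨW : W → Eucl dz → ℝ} {M R ζ₁ ζ₂ : ℝ}
  {zstar : ℝ → P2 dx → P2 dz} {σ : ℕ → ℝ × ℝ}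

theorem nestedII_zero (μx : P2 dx) : nestedII ρ ΨW ζ₂ zstar (0, 0) μx
    = ((U₂ ρ ΨW (zstar 0 μx) + ζ₂ / 2 * secondMoment μx : ℝ) : EReal) := by
  simp [nestedII, stageII]

theorem le_nestedII {s : ℝ × ℝ} (hs : 0 ≤ s.2) (μx : P2 dx) :
    ((U₂ ρ ΨW (zstar s.1 μx) + (ζ₂ / 2 - s.2) * secondMoment μx
      - s.2 * entConj 1 (0 : Eucl dx → ℝ) : ℝ) : EReal) ≤ nestedII ρ ΨW ζ₂ zstar s μx := by
  refine le_trans (EReal.coe_le_coe_iff.2 (le_of_eq ?_))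
    (le_add_coe_mul hs (neg_secondMoment_le_ent μx one_pos))
  ring

variable [IsProbabilityMeasure ρ]

theorem tendsto_U₂_zstar (hM : ∀ᵐ t ∂ρ, |t.2.1| ≤ M) (hA : BoundedSmooth ΨA R)
    (hW : BoundedSmooth ΨW R) (hζ₁ : 0 < ζ₁)
    (hz : ∀ σ₁ : ℝ, 0 ≤ σ₁ → ∀ μx : P2 dx, IsStageISolution ρ ΨA ΨW ζ₁ σ₁ μx (zstar σ₁ μx))
    (hσ : ∀ n, 0 < (σ n).1 ∧ 0 < (σ n).2) (hσ0 : Tendsto σ atTop (𝓝 (0, 0)))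
    {u : ℕ → P2 dx} {μ : P2 dx} (hu : Tendsto u atTop (𝓝 μ)) :
    Tendsto (fun n => U₂ ρ ΨW (zstar (σ n).1 (u n))) atTop (𝓝 (U₂ ρ ΨW (zstar 0 μ))) :=
  tendsto_U₂_of_isStageISolution hM hA hW hζ₁ (fun n => (hσ n).1)
    ((continuous_fst.tendsto _).comp hσ0) hu (fun n => hz _ (hσ n).1.le _) (hz 0 le_rfl μ)

theorem exists_recovery_nestedII (hM : ∀ᵐ t ∂ρ, |t.2.1| ≤ M) (hA : BoundedSmooth ΨA R)
    (hW : BoundedSmooth ΨW R) (hζ₁ : 0 < ζ₁)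
    (hz : ∀ σ₁ : ℝ, 0 ≤ σ₁ → ∀ μx : P2 dx, IsStageISolution ρ ΨA ΨW ζ₁ σ₁ μx (zstar σ₁ μx))
    (hσ : ∀ n, 0 < (σ n).1 ∧ 0 < (σ n).2) (hσ0 : Tendsto σ atTop (𝓝 (0, 0))) (μ : P2 dx) :
    ∃ (u : ℕ → P2 dx) (r : ℕ → ℝ), Tendsto u atTop (𝓝 μ) ∧
      (∀ n, nestedII ρ ΨW ζ₂ zstar (σ n) (u n) ≤ (r n : EReal)) ∧
      Tendsto r atTop (𝓝 (U₂ ρ ΨW (zstar 0 μ) + ζ₂ / 2 * secondMoment μ)) := by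
  obtain ⟨u, e, hu, hum, hue, hse⟩ := exists_recovery μ (fun n => (hσ n).2)
    ((continuous_snd.tendsto _).comp hσ0)
  refine ⟨u, _, hu, fun n => add_coe_mul_le (hσ n).2.le (hue n), ?_⟩
  have := ((tendsto_U₂_zstar hM hA hW hζ₁ hz hσ hσ0 hu).add (hum.const_mul (ζ₂ / 2))).add hse
  rwa [add_zero] at this

theorem gammaConverges_nestedII (hM : ∀ᵐ t ∂ρ, |t.2.1| ≤ M) (hA : BoundedSmooth ΨA R)
    (hW : BoundedSmooth ΨW R) (hζ₁ : 0 < ζ₁) (hζ₂ : 0 < ζ₂)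
    (hz : ∀ σ₁ : ℝ, 0 ≤ σ₁ → ∀ μx : P2 dx, IsStageISolution ρ ΨA ΨW ζ₁ σ₁ μx (zstar σ₁ μx))
    (hσ : ∀ n, 0 < (σ n).1 ∧ 0 < (σ n).2) (hσ0 : Tendsto σ atTop (𝓝 (0, 0))) :
    GammaConverges (fun n => nestedII ρ ΨW ζ₂ zstar (σ n)) (nestedII ρ ΨW ζ₂ zstar (0, 0)) where
  le_liminf μ u hu := by
    have hσ2 : Tendsto (fun n => (σ n).2) atTop (𝓝 0) := (continuous_snd.tendsto _).comp hσ0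
    rw [nestedII_zero]
    set G := U₂ ρ ΨW (zstar 0 μ) + ζ₂ / 2 * secondMoment μ with hG
    set K := entConj 1 (0 : Eucl dx → ℝ)
    refine EReal.ge_of_forall_gt_iff_ge.1 fun y hy => ?_
    rw [EReal.coe_lt_coe_iff] at hy
    -- A level just below the second moment of `μ`: lower semicontinuity keeps `u n` above it
    -- eventually, and it gives up only half of the gap `G - y`.
    set m := secondMoment μ - (G - y) / ζ₂ with hm
    have hlim : Tendsto (fun n => U₂ ρ ΨW (zstar (σ n).1 (u n)) + (ζ₂ / 2 - (σ n).2) * m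
        - (σ n).2 * K) atTop (𝓝 (U₂ ρ ΨW (zstar 0 μ) + ζ₂ / 2 * m)) := by
      have := ((tendsto_U₂_zstar hM hA hW hζ₁ hz hσ hσ0 hu).add
        ((hσ2.const_sub (ζ₂ / 2)).mul_const m)).sub (hσ2.mul_const K)
      simpa using this
    have hylt : y < U₂ ρ ΨW (zstar 0 μ) + ζ₂ / 2 * m := by
      have : ζ₂ / 2 * m = ζ₂ / 2 * secondMoment μ - (G - y) / 2 := by rw [hm]; field_simp
      rw [this]
      linarith
    have hmlt : m < secondMoment μ := by
      rw [hm]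
      linarith [div_pos (sub_pos.2 hy) hζ₂]
    refine le_liminf_of_le (h := ?_)
    filter_upwards [hlim.eventually_const_lt hylt,
      hu.eventually (lowerSemicontinuous_secondMoment μ m hmlt),
      hσ2.eventually_le_const (show (0 : ℝ) < ζ₂ / 2 by positivity)] with n h1 h2 h3
    refine le_trans (EReal.coe_le_coe_iff.2 ?_) (le_nestedII (hσ n).2.le (u n))
    have := mul_le_mul_of_nonneg_left h2.le (sub_nonneg.2 h3)
    linarith
  exists_recovery μ := by
    obtain ⟨u, r, hu, hr, hlim⟩ := exists_recovery_nestedII (ζ₂ := ζ₂) hM hA hW hζ₁ hz hσ hσ0 μ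
    refine ⟨u, hu, ?_⟩
    rw [nestedII_zero, ← ((continuous_coe_real_ereal.tendsto _).comp hlim).limsup_eq]
    exact limsup_le_limsup (.of_forall hr)

/-- A recovery sequence bounds the minimal values, hence the second moments of the minimizers. So
the limit is in `𝒫₂`, where the usual Γ-convergence comparison applies. -/
theorem isMin_nestedII_of_tendsto (hM : ∀ᵐ t ∂ρ, |t.2.1| ≤ M) (hA : BoundedSmooth ΨA R)
    (hW : BoundedSmooth ΨW R) (hζ₁ : 0 < ζ₁) (hζ₂ : 0 < ζ₂)
    (hz : ∀ σ₁ : ℝ, 0 ≤ σ₁ → ∀ μx : P2 dx, IsStageISolution ρ ΨA ΨW ζ₁ σ₁ μx (zstar σ₁ μx))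
    (hσ : ∀ n, 0 < (σ n).1 ∧ 0 < (σ n).2) (hσ0 : Tendsto σ atTop (𝓝 (0, 0)))
    {m : ℕ → P2 dx} {μ : ProbabilityMeasure (Eucl dx)}
    (hmin : ∀ n ν, nestedII ρ ΨW ζ₂ zstar (σ n) (m n) ≤ nestedII ρ ΨW ζ₂ zstar (σ n) ν)
    (hm : Tendsto (fun n => (m n).1) atTop (𝓝 μ)) :
    ∃ μlim : P2 dx, μlim.1 = μ ∧
      ∀ ν, nestedII ρ ΨW ζ₂ zstar (0, 0) μlim ≤ nestedII ρ ΨW ζ₂ zstar (0, 0) ν := by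
  have hσ2 : Tendsto (fun n => (σ n).2) atTop (𝓝 0) := (continuous_snd.tendsto _).comp hσ0
  -- Any point of `𝒫₂` serves as reference.
  obtain ⟨ν₀, -⟩ := exists_ent_le dx
  obtain ⟨u₀, r, -, hr, hlim⟩ := exists_recovery_nestedII (ζ₂ := ζ₂) hM hA hW hζ₁ hz hσ hσ0 ν₀
  set G := U₂ ρ ΨW (zstar 0 ν₀) + ζ₂ / 2 * secondMoment ν₀
  set K := entConj 1 (0 : Eucl dx → ℝ)
  have hlim' : Tendsto (fun n => r n + (σ n).2 * K) atTop (𝓝 G) := by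
    simpa using hlim.add (hσ2.mul_const K)
  have hbound : ∀ᶠ n in atTop, secondMoment (m n) ≤ 4 / ζ₂ * (G + 1) := by
    filter_upwards [hlim'.eventually_le_const (lt_add_one G),
      hσ2.eventually_le_const (show (0 : ℝ) < ζ₂ / 4 by positivity)] with n h1 h2
    have h3 := EReal.coe_le_coe_iff.1
      ((le_nestedII (hσ n).2.le (m n)).trans ((hmin n (u₀ n)).trans (hr n)))
    have h4 := U₂_nonneg (ρ := ρ) (ΨW := ΨW) (zstar (σ n).1 (m n))
    have h5 := secondMoment_nonneg (m n)
    rw [div_mul_eq_mul_div, le_div_iff₀ hζ₂]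
    nlinarith
  have hΓ := gammaConverges_nestedII hM hA hW hζ₁ hζ₂ hz hσ hσ0
  refine ⟨⟨μ, (integrable_sq_norm_of_tendsto hm hbound).1⟩, rfl, fun ν => ?_⟩
  obtain ⟨u, -, hu⟩ := hΓ.exists_recovery ν
  refine (hΓ.le_liminf _ m (tendsto_subtype_rng.2 hm)).trans (le_trans ?_ hu)
  exact (liminf_le_liminf (.of_forall fun n => hmin n (u n))).trans liminf_le_limsup

end Gamma

end DFIV

theorem mainTheorem5 {A W : Type*} [MeasurableSpace A] [MeasurableSpace W] {dx dz : ℕ}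
    (ρ : Measure (A × ℝ × W)) [IsProbabilityMeasure ρ]
    (ΨA : A → DFIV.Eucl dx → ℝ) (ΨW : W → DFIV.Eucl dz → ℝ)
    (M R ζ₁ ζ₂ : ℝ) (hζ₁ : 0 < ζ₁) (hζ₂ : 0 < ζ₂)
    (hM : ∀ᵐ t ∂ρ, |t.2.1| ≤ M)
    (hA : DFIV.BoundedSmooth ΨA R) (hW : DFIV.BoundedSmooth ΨW R) :
    -- Stage I is solvable for all `σ₁ ≥ 0`, and the Stage II error does not depend on the solution
    (∀ σ₁ : ℝ, 0 ≤ σ₁ → ∀ μx : DFIV.P2 dx,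
      (∃ μz : DFIV.P2 dz, DFIV.IsStageISolution ρ ΨA ΨW ζ₁ σ₁ μx μz) ∧
      ∀ μz μz' : DFIV.P2 dz, DFIV.IsStageISolution ρ ΨA ΨW ζ₁ σ₁ μx μz →
        DFIV.IsStageISolution ρ ΨA ΨW ζ₁ σ₁ μx μz' → DFIV.U₂ ρ ΨW μz = DFIV.U₂ ρ ΨW μz') ∧
    ∀ zstar : ℝ → DFIV.P2 dx → DFIV.P2 dz,
      (∀ σ₁ : ℝ, 0 ≤ σ₁ → ∀ μx : DFIV.P2 dx,
        DFIV.IsStageISolution ρ ΨA ΨW ζ₁ σ₁ μx (zstar σ₁ μx)) →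
      ∀ σ : ℕ → ℝ × ℝ, (∀ n, 0 < (σ n).1 ∧ 0 < (σ n).2) → Tendsto σ atTop (𝓝 (0, 0)) →
        -- Γ-convergence for the weak topology
        DFIV.GammaConverges (fun n => DFIV.nestedII ρ ΨW ζ₂ zstar (σ n))
          (DFIV.nestedII ρ ΨW ζ₂ zstar (0, 0)) ∧
        -- weak limits of global minimizers are global minimizers of the unregularized problem
        ∀ (m : ℕ → DFIV.P2 dx) (μ : ProbabilityMeasure (DFIV.Eucl dx)),
          (∀ n ν, DFIV.nestedII ρ ΨW ζ₂ zstar (σ n) (m n) ≤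
            DFIV.nestedII ρ ΨW ζ₂ zstar (σ n) ν) →
          Tendsto (fun n => (m n).1) atTop (𝓝 μ) →
          ∃ μlim : DFIV.P2 dx, μlim.1 = μ ∧
            ∀ ν, DFIV.nestedII ρ ΨW ζ₂ zstar (0, 0) μlim ≤
              DFIV.nestedII ρ ΨW ζ₂ zstar (0, 0) ν := by
  refine ⟨fun σ₁ hσ₁ μx => ⟨DFIV.exists_isStageISolution hA hW hζ₁ hσ₁ μx,
    fun μz μz' h h' => h.U₂_eq hM hA hW hσ₁ h'⟩, fun zstar hz σ hσ hσ0 =>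
    ⟨DFIV.gammaConverges_nestedII hM hA hW hζ₁ hζ₂ hz hσ hσ0, fun m μ hmin hm =>
      DFIV.isMin_nestedII_of_tendsto hM hA hW hζ₁ hζ₂ hz hσ hσ0 hmin hm⟩⟩
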